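/- Let $\Gamma$ be a finite simple connected graph with vertex set $X$, path-length distance $\partial$ and diameter $D\ge 3$, and write $\Gamma_i(x)=\{y\in X:\partial(x,y)=i\}$. Assume $\Gamma$ is distance-regular, i.e. for $0\le h,i,j\le D$ the number $p^h_{ij}=|\Gamma_i(x)\cap\Gamma_j(y)|$ is the same for all $x,y\in X$ with $\partial(x,y)=h$. Put $c_i=p^i_{1,i-1}$ $(1\le i\le D)$, $a_i=p^i_{1,i}$ $(0\le i\le D)$, $b_i=p^i_{1,i+1}$ $(0\le i\le D-1)$. Assume that $\Gamma$ has classical parameters $(D,b,\alpha,\beta)$ with real $b<-1$ and real $\alpha,\beta$; that is, with ${j \brack 1}=1+b+\cdots+b^{j-1}$, $$c_i={i\brack 1}\Bigl(1+\alpha{i-1\brack 1}\Bigr)\ (1\le i\le D),\qquad b_i=\Bigl({D\brack 1}-{i\brack 1}\Bigr)\Bigl(\beta-\alpha{i\brack 1}\Bigr)\ (0\le i\le D-1).$$ Assume further that $a_1\ne 0$ and that $\Gamma$ is not a near polygon, where $\Gamma$ is called a near polygon if $a_i=a_1c_i$ for $1\le i\le D-1$ and there are no vertices $u,v,w,z$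 with $u,v,w$ mutually adjacent, $\partial(u,z)=2$ and $\partial(v,z)=\partial(w,z)=1$. Let $A_i$ $(0\le i\le D)$ be the $i$th distance matrix, with $(y,z)$-entry $1$ if $\partial(y,z)=i$ and $0$ otherwise, and let $A=A_1$. Fix $x\in X$ and let $E^*_i$ $(0\le i\le D)$ be the diagonal matrix with $(y,y)$-entry $1$ if $\partial(x,y)=i$ and $0$ otherwise. Let $T$ be the subalgebra of $\mathrm{Mat}_X(\mathbb C)$ generated by $A_0,\dots,A_D,E^*_0,\dots,E^*_D$ (the Terwilliger algebra with respect to $x$). A $T$-module is a subspace $W\subseteq\mathbb C^X$ with $BW\subseteq W$ for all $B\in T$; it is irreducible if it is nonzero and contains no $T$-modules other than $0$ and $W$. The endpoint of an irreducible $T$-module $W$ is $\min\{i: 0\le i\le D,\ E^*_iW\ne 0\}$ and its diameter is $|\{i:0\le i\le D,\ E^*_iW\neq 0\}|-1$. If $W$ has endpoint $1$, it has local eigenvalue $\eta$ if $E^*_1AE^*_1v=\eta v$ for all $v\in E^*_1W$. Let $W$ be an irreducible $T$-module with endpoint $1$ and local eigenvalue $-1$. Then: 1. for every nonzero $w\in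 E^*_1W$, the vectors $E^*_iA_{i-1}w$ $(1\le i\le D)$ form a basis of $W$; 2. $\dim E^*_iW=1$ for $1\le i\le D$; 3. $\dim W=D$; 4. the diameter of $W$ is $D-1$. -/

import Mathlib

noncomputable section

namespace DRG

section Graph

variable {X : Type*} [Fintype X]

/-- The set `Γ_i(x)` of vertices at distance `i` from `x`
(used for connected graphs only, where `G.dist` is the path-length distance). -/
def sphere (G : SimpleGraph X) (x : X) (i : ℕ) : Finset X :=
  Finset.univ.filter fun y => G.dist x y = i

/-- `G` is distance-regular: it is connected and, for `0 ≤ h, i, j ≤ D`, the number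
`|Γ_i(x) ∩ Γ_j(y)|` is the same for all `x, y` with `∂(x, y) = h`. -/
def IsDistanceRegular [DecidableEq X] (G : SimpleGraph X) : Prop :=
  G.Connected ∧ ∀ h i j : ℕ, h ≤ G.diam → i ≤ G.diam → j ≤ G.diam →
    ∀ x y x' y' : X, G.dist x y = h → G.dist x' y' = h →
      (sphere G x i ∩ sphere G y j).card = (sphere G x' i ∩ sphere G y' j).card

/-- The intersection number `p^h_{ij}`: the largest value of `|Γ_i(x) ∩ Γ_j(y)|` over all `x, y`
with `∂(x, y) = h`. For a distance-regular graph this is the common value, see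
`card_sphere_inter_sphere`. -/
def intersectionNumber [DecidableEq X] (G : SimpleGraph X) (h i j : ℕ) : ℕ :=
  (Finset.univ.filter fun q : X × X => G.dist q.1 q.2 = h).sup
    fun q => (sphere G q.1 i ∩ sphere G q.2 j).card

theorem card_sphere_inter_sphere [DecidableEq X] {G : SimpleGraph X} (hG : IsDistanceRegular G)
    {h i j : ℕ} (hh : h ≤ G.diam) (hi : i ≤ G.diam) (hj : j ≤ G.diam) {x y : X}
    (hxy : G.dist x y = h) :
    (sphere G x i ∩ sphere G y j).card = intersectionNumber G h i j := by
  apply le_antisymm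
  · exact Finset.le_sup (f := fun q : X × X => (sphere G q.1 i ∩ sphere G q.2 j).card)
      (b := (x, y)) (by simp [hxy])
  · refine Finset.sup_le fun q hq => ?_
    simp only [Finset.mem_filter, Finset.mem_univ, true_and] at hq
    exact (hG.2 h i j hh hi hj q.1 q.2 x y hq hxy).le

/-- `c_i = p^i_{1,i-1}` (for `i ≥ 1`). -/
def cNum [DecidableEq X] (G : SimpleGraph X) (i : ℕ) : ℕ := intersectionNumber G i 1 (i - 1)

/-- `a_i = p^i_{1,i}`. -/
def aNum [DecidableEq X] (G : SimpleGraph X) (i : ℕ) : ℕ := intersectionNumber G i 1 i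

/-- `b_i = p^i_{1,i+1}`. -/
def bNum [DecidableEq X] (G : SimpleGraph X) (i : ℕ) : ℕ := intersectionNumber G i 1 (i + 1)

/-- The bracket `[j 1] = 1 + b + ⋯ + b^{j-1}`. -/
def bracket (b : ℝ) (j : ℕ) : ℝ := ∑ l ∈ Finset.range j, b ^ l

/-- `G` has diameter `D` and classical parameters `(D, b, α, β)`. -/
def HasClassicalParameters [DecidableEq X] (G : SimpleGraph X) (D : ℕ) (b α β : ℝ) : Prop :=
  G.diam = D ∧
  (∀ i : ℕ, 1 ≤ i → i ≤ D → (cNum G i : ℝ) = bracket b i * (1 + α * bracket b (i - 1))) ∧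
  (∀ i : ℕ, i < D → (bNum G i : ℝ) = (bracket b D - bracket b i) * (β - α * bracket b i))

/-- The 4-tuple `uvwz` is a kite of length `i`. -/
def IsKite {X : Type*} (G : SimpleGraph X) (i : ℕ) (u v w z : X) : Prop :=
  G.Adj u v ∧ G.Adj v w ∧ G.Adj u w ∧
    G.dist u z = i ∧ G.dist v z = i - 1 ∧ G.dist w z = i - 1

/-- `G` is a near polygon: `a_i = a_1 c_i` for `1 ≤ i ≤ D - 1` and there is no `2`-kite. -/
def IsNearPolygon [DecidableEq X] (G : SimpleGraph X) : Prop :=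
  (∀ i : ℕ, 1 ≤ i → i < G.diam → aNum G i = aNum G 1 * cNum G i) ∧
    ¬ ∃ u v w z : X, IsKite G 2 u v w z

end Graph

section Terwilliger

variable {X : Type*} [Fintype X] [DecidableEq X]

/-- The `i`th distance matrix `A_i`; `A = A_1` is the adjacency matrix. -/
def distMatrix (G : SimpleGraph X) (i : ℕ) : Matrix X X ℂ :=
  Matrix.of fun y z => if G.dist y z = i then 1 else 0

/-- The `i`th dual idempotent `E*_i = E*_i(x)`. -/
def dualIdempotent (G : SimpleGraph X) (x : X) (i : ℕ) : Matrix X X ℂ :=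
  Matrix.diagonal fun y => if G.dist x y = i then 1 else 0

/-- The Bose–Mesner algebra `M`, as the span of `A_0, …, A_D`. -/
def boseMesner (G : SimpleGraph X) : Submodule ℂ (Matrix X X ℂ) :=
  Submodule.span ℂ (distMatrix G '' Set.Iic G.diam)

/-- The dual Bose–Mesner algebra `M* = M*(x)`, as the span of `E*_0, …, E*_D`. -/
def dualBoseMesner (G : SimpleGraph X) (x : X) : Submodule ℂ (Matrix X X ℂ) :=
  Submodule.span ℂ (dualIdempotent G x '' Set.Iic G.diam)

/-- The Terwilliger algebra `T = T(x)`: the subalgebra generated by `M` and `M*`. -/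
def terwilligerAlgebra (G : SimpleGraph X) (x : X) : Subalgebra ℂ (Matrix X X ℂ) :=
  Algebra.adjoin ℂ ((boseMesner G : Set (Matrix X X ℂ)) ∪ (dualBoseMesner G x : Set _))

/-- A `T`-module: a subspace `W` of the standard module `V = ℂ^X` with `B W ⊆ W` for `B ∈ T`. -/
def IsTModule (G : SimpleGraph X) (x : X) (W : Submodule ℂ (X → ℂ)) : Prop :=
  ∀ B ∈ terwilligerAlgebra G x, ∀ v ∈ W, B.mulVec v ∈ W

/-- An irreducible `T`-module: nonzero, containing no `T`-modules other than `0` and itself. -/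
def IsIrreducibleTModule (G : SimpleGraph X) (x : X) (W : Submodule ℂ (X → ℂ)) : Prop :=
  IsTModule G x W ∧ W ≠ ⊥ ∧ ∀ W' : Submodule ℂ (X → ℂ), IsTModule G x W' → W' ≤ W →
    W' = ⊥ ∨ W' = W

/-- The subspace `E*_i W`. -/
def dualComponent (G : SimpleGraph X) (x : X) (i : ℕ) (W : Submodule ℂ (X → ℂ)) :
    Submodule ℂ (X → ℂ) :=
  W.map (dualIdempotent G x i).mulVecLin

/-- The set `{i | 0 ≤ i ≤ D, E*_i W ≠ 0}` (nonempty when `W ≠ 0`). -/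
def dualSupport (G : SimpleGraph X) (x : X) (W : Submodule ℂ (X → ℂ)) : Set ℕ :=
  {i | i ≤ G.diam ∧ dualComponent G x i W ≠ ⊥}

/-- The endpoint of `W`: `min {i | 0 ≤ i ≤ D, E*_i W ≠ 0}`. -/
def endpoint (G : SimpleGraph X) (x : X) (W : Submodule ℂ (X → ℂ)) : ℕ :=
  sInf (dualSupport G x W)

/-- The diameter of `W`: `|{i | 0 ≤ i ≤ D, E*_i W ≠ 0}| - 1`. -/
def moduleDiameter (G : SimpleGraph X) (x : X) (W : Submodule ℂ (X → ℂ)) : ℕ :=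
  (dualSupport G x W).ncard - 1

/-- `η` is the local eigenvalue of `W` (`W` of endpoint `1`): `E*_1 W` is nonzero and consists of
eigenvectors of `E*_1 A E*_1` for `η`, together with `0`. -/
def HasLocalEigenvalue (G : SimpleGraph X) (x : X) (W : Submodule ℂ (X → ℂ)) (η : ℂ) : Prop :=
  dualComponent G x 1 W ≠ ⊥ ∧ ∀ v ∈ dualComponent G x 1 W,
    (dualIdempotent G x 1 * distMatrix G 1 * dualIdempotent G x 1).mulVec v = η • v

end Terwilliger

end DRG

end

/-!
Kites are excluded first. Let `S` be the diagonal matrix with entries `ξ + b ^ (-∂(x, y))`, the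
dual eigenvalues up to a factor. The matrix with entries `ξ + b ^ (-∂(y, z))` is a multiple of an
idempotent, so an identity between operators on sequences lifts to the tridiagonal relation for
`A` and `S`, with `β = b + b⁻¹`. As `b` is not a root of unity, this relation implies that for
polynomials `P`, `P'` in `A` the matrix `P S P' - P' S P` equals `N S - S N` for some polynomial
`N` in `A`. For `P = A` and `P' = A_j` this is the balanced set condition. Let `∂(x, y) = 1`,
`∂(y, z) = j + 1` and `∂(x, z) = j + 2`. The condition shows that the number of vertices adjacent
to `z` and at distance `j + 1` from `x` and `y` is `b ^ j` times the number of vertices completing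
`x`, `y`, `z` to a kite. For odd `j` the signs disagree unless there is no kite; a `2`-kite
extends to a `3`-kite; and for even `j ≥ 2` the first number is at least `c_{j+1} > b ^ j` times
the second.

Now let `w ∈ E*_1 W` and `v_i = E*_i A_{i-1} w`. Without kites, `A_{i+2} w` vanishes on
`Γ_{i+1}(x)`, because there it is the inner product of `w` with a function that is constant on the
components of the local graph. As `w` sums to zero, this gives `A_j w = v_{j+1} - v_j`, and the
three-term recurrence for the `A_j` becomes one for the `v_i`. Hence the `v_i` span a `T`-module.
-/

namespace DRG

section Counting

variable {X : Type*} [Fintype X] {G : SimpleGraph X}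

@[simp]
theorem mem_sphere {x y : X} {i : ℕ} : y ∈ sphere G x i ↔ G.dist x y = i := by
  simp [sphere]

variable [DecidableEq X]

theorem IsDistanceRegular.dist_le_diam (hG : IsDistanceRegular G) (y z : X) :
    G.dist y z ≤ G.diam := by
  have : Nonempty X := ⟨y⟩
  exact SimpleGraph.dist_le_diam (SimpleGraph.connected_iff_ediam_ne_top.1 hG.1)

theorem IsDistanceRegular.dist_eq_of_dist_eq_one (hG : IsDistanceRegular G) {y t : X}
    (h : G.dist y t = 1) (z : X) :
    G.dist t z + 1 = G.dist y z ∨ G.dist t z = G.dist y z ∨ G.dist t z = G.dist y z + 1 := by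
  have hyz := hG.1.dist_triangle (u := y) (v := t) (w := z)
  have htz := hG.1.dist_triangle (u := t) (v := y) (w := z)
  rw [SimpleGraph.dist_comm (u := t) (v := y)] at htz
  omega

theorem IsDistanceRegular.sphere_eq_empty (hG : IsDistanceRegular G) (x : X) {i : ℕ}
    (hi : G.diam < i) : sphere G x i = ∅ := by
  refine Finset.eq_empty_of_forall_notMem fun y hy => ?_
  have := hG.dist_le_diam x y
  rw [mem_sphere] at hy
  omega

theorem IsDistanceRegular.card_inter_sphere (hG : IsDistanceRegular G) (x y : X) (i j : ℕ) :
    (sphere G x i ∩ sphere G y j).card = intersectionNumber G (G.dist x y) i j := by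
  by_cases hij : i ≤ G.diam ∧ j ≤ G.diam
  · exact card_sphere_inter_sphere hG (hG.dist_le_diam x y) hij.1 hij.2 rfl
  · have hempty (u v : X) : sphere G u i ∩ sphere G v j = ∅ := by
      rcases not_and_or.1 hij with hi | hj
      · rw [hG.sphere_eq_empty u (not_le.1 hi), Finset.empty_inter]
      · rw [hG.sphere_eq_empty v (not_le.1 hj), Finset.inter_empty]
    simp only [intersectionNumber, hempty, Finset.card_empty, ← bot_eq_zero, Finset.sup_bot]

theorem IsDistanceRegular.exists_dist_eq_one_of_dist_eq_succ (hG : IsDistanceRegular G) {y z : X}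
    {h : ℕ} (hyz : G.dist y z = h + 1) : ∃ t, G.dist y t = 1 ∧ G.dist t z = h := by
  obtain ⟨p, hp⟩ := hG.1.exists_walk_length_eq_dist y z
  have htake := SimpleGraph.dist_le (p.take 1)
  have hdrop := SimpleGraph.dist_le (p.drop 1)
  have htri := hG.1.dist_triangle (u := y) (v := p.getVert 1) (w := z)
  rw [SimpleGraph.Walk.take_length] at htake
  rw [SimpleGraph.Walk.drop_length] at hdrop
  exact ⟨p.getVert 1, by omega, by omega⟩

theorem IsDistanceRegular.card_sphere_eq (hG : IsDistanceRegular G) (x y : X) (i : ℕ) :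
    (sphere G x i).card = (sphere G y i).card := by
  simpa using (hG.card_inter_sphere x x i i).trans
    ((hG.card_inter_sphere y y i i).trans (by simp)).symm

theorem IsDistanceRegular.exists_dist_eq (hG : IsDistanceRegular G) (x : X) {h : ℕ}
    (hh : h ≤ G.diam) : ∃ y, G.dist x y = h := by
  suffices H : ∃ u y, G.dist u y = h by
    obtain ⟨u, y, huy⟩ := H
    have hpos : 0 < (sphere G u h).card := Finset.card_pos.2 ⟨y, mem_sphere.2 huy⟩
    rw [hG.card_sphere_eq u x] at hpos
    simpa [Finset.Nonempty] using Finset.card_pos.1 hpos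
  induction hh using Nat.decreasingInduction with
  | self =>
    have := hG.1.nonempty
    exact G.exists_dist_eq_diam
  | of_succ h _ ih =>
    obtain ⟨u, y, huy⟩ := ih
    obtain ⟨t, -, hty⟩ := hG.exists_dist_eq_one_of_dist_eq_succ huy
    exact ⟨t, y, hty⟩

theorem IsDistanceRegular.card_cNum (hG : IsDistanceRegular G) (y z : X) :
    (sphere G y 1 ∩ sphere G z (G.dist y z - 1)).card = cNum G (G.dist y z) :=
  hG.card_inter_sphere y z 1 _

theorem IsDistanceRegular.card_aNum (hG : IsDistanceRegular G) (y z : X) :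
    (sphere G y 1 ∩ sphere G z (G.dist y z)).card = aNum G (G.dist y z) :=
  hG.card_inter_sphere y z 1 _

theorem IsDistanceRegular.card_bNum (hG : IsDistanceRegular G) (y z : X) :
    (sphere G y 1 ∩ sphere G z (G.dist y z + 1)).card = bNum G (G.dist y z) :=
  hG.card_inter_sphere y z 1 _

theorem IsDistanceRegular.cNum_pos (hG : IsDistanceRegular G) {h : ℕ} (h0 : 1 ≤ h)
    (hh : h ≤ G.diam) : 0 < cNum G h := by
  obtain ⟨y⟩ := hG.1.nonempty
  obtain ⟨z, rfl⟩ := hG.exists_dist_eq y hh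
  obtain ⟨t, hyt, htz⟩ := hG.exists_dist_eq_one_of_dist_eq_succ (Nat.sub_add_cancel h0).symm
  rw [← hG.card_cNum, Finset.card_pos]
  exact ⟨t, by simp [hyt, SimpleGraph.dist_comm (u := z), htz]⟩

theorem IsDistanceRegular.bNum_pos (hG : IsDistanceRegular G) {h : ℕ} (hh : h < G.diam) :
    0 < bNum G h := by
  obtain ⟨y⟩ := hG.1.nonempty
  obtain ⟨z, hyz⟩ := hG.exists_dist_eq y (Nat.succ_le_of_lt hh)
  obtain ⟨t, hyt, rfl⟩ := hG.exists_dist_eq_one_of_dist_eq_succ hyz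
  rw [← hG.card_bNum, Finset.card_pos]
  exact ⟨y, by simp [SimpleGraph.dist_comm (v := y), hyt, hyz]⟩

theorem IsDistanceRegular.exists_dist_eq_one_of_dist_lt_diam (hG : IsDistanceRegular G) {y z : X}
    (h : G.dist y z < G.diam) : ∃ t, G.dist y t = 1 ∧ G.dist t z = G.dist y z + 1 := by
  have hpos := hG.bNum_pos h
  rw [← hG.card_bNum, Finset.card_pos] at hpos
  obtain ⟨t, ht⟩ := hpos
  exact ⟨t, by simpa [SimpleGraph.dist_comm (u := z)] using ht⟩

theorem IsDistanceRegular.bNum_diam (hG : IsDistanceRegular G) : bNum G G.diam = 0 := by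
  simp [bNum, intersectionNumber, hG.sphere_eq_empty _ (Nat.lt_succ_self _)]

theorem IsDistanceRegular.sum_sphere_one (hG : IsDistanceRegular G) {R : Type*} [CommRing R]
    (g : ℤ → R) (y z : X) :
    ∑ t ∈ sphere G y 1, g (G.dist t z) =
      cNum G (G.dist y z) * g (G.dist y z - 1) + aNum G (G.dist y z) * g (G.dist y z) +
        bNum G (G.dist y z) * g (G.dist y z + 1) := by
  have hsplit (t : X) (ht : t ∈ sphere G y 1) : g (G.dist t z) =
      (if t ∈ sphere G z (G.dist y z - 1) then g (G.dist y z - 1) else 0) +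
        (if t ∈ sphere G z (G.dist y z) then g (G.dist y z) else 0) +
        (if t ∈ sphere G z (G.dist y z + 1) then g (G.dist y z + 1) else 0) := by
    simp only [mem_sphere, SimpleGraph.dist_comm (u := z)] at ht ⊢
    rcases hG.dist_eq_of_dist_eq_one ht z with h | h | h
    · simp [← h, show G.dist t z ≠ G.dist t z + 1 + 1 by omega]
    · have hne : G.dist y z ≠ G.dist y z - 1 := by
        intro h0
        have hyz : y = z := hG.1.dist_eq_zero_iff.1 (by omega)
        rw [hyz, SimpleGraph.dist_self, ← hyz, SimpleGraph.dist_comm, ht] at h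
        omega
      simp [h, hne]
    · simp [h, show G.dist y z + 1 ≠ G.dist y z - 1 by omega]
  rw [Finset.sum_congr rfl hsplit]
  simp only [Finset.sum_add_distrib, Finset.sum_ite_mem, Finset.sum_const, nsmul_eq_mul,
    hG.card_cNum, hG.card_aNum, hG.card_bNum]

theorem IsDistanceRegular.card_sphere_one (hG : IsDistanceRegular G) (y : X) :
    (sphere G y 1).card = bNum G 0 := by
  simpa using hG.card_bNum y y

theorem IsDistanceRegular.cNum_add_aNum_add_bNum (hG : IsDistanceRegular G) {h : ℕ}
    (hh : h ≤ G.diam) : cNum G h + aNum G h + bNum G h = bNum G 0 := by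
  obtain ⟨y⟩ := hG.1.nonempty
  obtain ⟨z, rfl⟩ := hG.exists_dist_eq y hh
  have hsum := hG.sum_sphere_one (fun _ => (1 : ℤ)) y z
  rw [Finset.sum_const, hG.card_sphere_one] at hsum
  simp only [nsmul_eq_mul, mul_one] at hsum
  exact_mod_cast hsum.symm

theorem IsDistanceRegular.cNum_zero (hG : IsDistanceRegular G) : cNum G 0 = 0 := by
  obtain ⟨y⟩ := hG.1.nonempty
  rw [← SimpleGraph.dist_self (G := G) (v := y), ← hG.card_cNum, SimpleGraph.dist_self,
    Finset.card_eq_zero, ← Finset.disjoint_iff_inter_eq_empty, Finset.disjoint_left]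
  exact fun t ht ht' => by simp_all only [mem_sphere, zero_tsub, one_ne_zero]

theorem IsDistanceRegular.cNum_one (hG : IsDistanceRegular G) (hD : 1 ≤ G.diam) :
    cNum G 1 = 1 := by
  obtain ⟨y⟩ := hG.1.nonempty
  obtain ⟨z, hyz⟩ := hG.exists_dist_eq y hD
  rw [← hyz, ← hG.card_cNum, hyz, Finset.card_eq_one]
  refine ⟨z, Finset.ext fun t => ?_⟩
  simp only [Finset.mem_inter, mem_sphere, Nat.sub_self, Finset.mem_singleton,
    hG.1.dist_eq_zero_iff]
  exact ⟨fun h => h.2.symm, fun h => ⟨h ▸ hyz, h.symm⟩⟩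

end Counting

section Sequences

variable {R : Type*} [CommRing R]

/-- The operator on sequences by which multiplication by a tridiagonal matrix acts; for a
distance-regular graph the coefficients are `c_h`, `a_h`, `b_h`. Sequences are indexed by `ℤ` so
that no boundary terms have to be treated separately. -/
def threeTerm (c a b : ℤ → R) : Module.End R (ℤ → R) where
  toFun g h := c h * g (h - 1) + a h * g h + b h * g (h + 1)
  map_add' g g' := by ext h; simp only [Pi.add_apply]; ring
  map_smul' r g := by ext h; simp only [Pi.smul_apply, smul_eq_mul, RingHom.id_apply]; ring

theorem threeTerm_apply (c a b g : ℤ → R) (h : ℤ) :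
    threeTerm c a b g h = c h * g (h - 1) + a h * g h + b h * g (h + 1) := rfl

theorem threeTerm_single (c a b : ℤ → R) (i : ℤ) :
    threeTerm c a b (Pi.single i 1) =
      c (i + 1) • Pi.single (i + 1) 1 + a i • Pi.single i 1 + b (i - 1) • Pi.single (i - 1) 1 := by
  ext h
  simp only [threeTerm_apply, Pi.add_apply, Pi.smul_apply, smul_eq_mul, Pi.single_apply,
    sub_eq_iff_eq_add, eq_sub_iff_add_eq, mul_ite, mul_one, mul_zero]
  grind

end Sequences

section DistFun

variable {X : Type*} {G : SimpleGraph X} {R : Type*} [CommRing R]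

variable (G) in
/-- The matrix with `(y, z)`-entry `g (∂(y, z))`, linearly in the sequence `g`. -/
noncomputable def distFun : (ℤ → R) →ₗ[R] Matrix X X R where
  toFun g := Matrix.of fun y z => g (G.dist y z)
  map_add' _ _ := rfl
  map_smul' _ _ := rfl

theorem distFun_apply (g : ℤ → R) (y z : X) : distFun G g y z = g (G.dist y z) := rfl

variable (G R) in
/-- The `i`th distance matrix over `R`. -/
noncomputable abbrev distMatrixOver (i : ℕ) : Matrix X X R := distFun G (Pi.single (i : ℤ) 1)

theorem distMatrixOver_apply (i : ℕ) (y z : X) :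
    distMatrixOver G R i y z = if G.dist y z = i then 1 else 0 := by
  simp [distFun_apply, Pi.single_apply]

theorem distMatrix_eq_distMatrixOver (i : ℕ) : distMatrix G i = distMatrixOver G ℂ i := by
  ext y z
  rw [distMatrixOver_apply, distMatrix, Matrix.of_apply]

theorem distFun_isSymm (g : ℤ → R) : (distFun G g).IsSymm := by
  ext y z
  rw [Matrix.transpose_apply, distFun_apply, distFun_apply, SimpleGraph.dist_comm]

variable [Fintype X]

theorem distMatrixOver_mulVec (i : ℕ) (f : X → R) (y : X) :
    (distMatrixOver G R i).mulVec f y = ∑ t ∈ sphere G y i, f t := by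
  simp only [Matrix.mulVec, dotProduct, distMatrixOver_apply, ite_mul, one_mul, zero_mul, sphere,
    Finset.sum_filter]

variable [DecidableEq X]

theorem IsDistanceRegular.distMatrixOver_zero (hG : IsDistanceRegular G) :
    distMatrixOver G R 0 = 1 := by
  ext y z
  simp only [distMatrixOver_apply, Matrix.one_apply, hG.1.dist_eq_zero_iff]

theorem IsDistanceRegular.distMatrixOver_one_mul_distFun (hG : IsDistanceRegular G) (g : ℤ → R) :
    distMatrixOver G R 1 * distFun G g =
      distFun G (threeTerm (fun h => (cNum G h.toNat : R)) (fun h => (aNum G h.toNat : R))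
        (fun h => (bNum G h.toNat : R)) g) := by
  ext y z
  rw [distFun_apply, threeTerm_apply, Int.toNat_natCast, ← hG.sum_sphere_one g y z]
  exact distMatrixOver_mulVec 1 _ y

theorem IsDistanceRegular.distMatrixOver_one_mul (hG : IsDistanceRegular G) (i : ℕ) :
    distMatrixOver G R 1 * distMatrixOver G R (i + 1) =
      (cNum G (i + 2) : R) • distMatrixOver G R (i + 2) +
        (aNum G (i + 1) : R) • distMatrixOver G R (i + 1) +
        (bNum G i : R) • distMatrixOver G R i := by
  rw [hG.distMatrixOver_one_mul_distFun, threeTerm_single, map_add, map_add, map_smul, map_smul,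
    map_smul]
  congr <;> grind

theorem IsDistanceRegular.distMatrixOver_of_diam_lt (hG : IsDistanceRegular G) {i : ℕ}
    (hi : G.diam < i) : distMatrixOver G R i = 0 := by
  ext y z
  have := hG.dist_le_diam y z
  rw [distMatrixOver_apply, if_neg (by omega), Matrix.zero_apply]

theorem IsDistanceRegular.distFun_eq_sum (hG : IsDistanceRegular G) (g : ℤ → R) :
    distFun G g = ∑ i ∈ Finset.range (G.diam + 1), g i • distMatrixOver G R i := by
  ext y z
  have := hG.dist_le_diam y z
  rw [distFun_apply]
  simp only [Matrix.sum_apply, Matrix.smul_apply, distMatrixOver_apply, smul_eq_mul, mul_ite,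
    mul_one, mul_zero, Finset.sum_ite_eq, Finset.mem_range, Nat.lt_succ_iff, this, if_true]

end DistFun

section BoseMesner

variable {X K : Type*} [Fintype X] [DecidableEq X] [Field K] [CharZero K] {G : SimpleGraph X}

theorem IsDistanceRegular.distMatrixOver_mem (hG : IsDistanceRegular G)
    {S : Subalgebra K (Matrix X X K)} (hS : distMatrixOver G K 1 ∈ S) :
    ∀ i, distMatrixOver G K i ∈ S
  | 0 => hG.distMatrixOver_zero (R := K) ▸ S.one_mem
  | 1 => hS
  | i + 2 => by
    rcases lt_or_ge G.diam (i + 2) with hi | hi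
    · exact hG.distMatrixOver_of_diam_lt (R := K) hi ▸ S.zero_mem
    have hc : (cNum G (i + 2) : K) ≠ 0 := Nat.cast_ne_zero.2 (hG.cNum_pos (by omega) hi).ne'
    have hrec : distMatrixOver G K (i + 2) = (cNum G (i + 2) : K)⁻¹ •
        (distMatrixOver G K 1 * distMatrixOver G K (i + 1) -
          (aNum G (i + 1) : K) • distMatrixOver G K (i + 1) -
          (bNum G i : K) • distMatrixOver G K i) := by
      rw [hG.distMatrixOver_one_mul, add_sub_right_comm, add_sub_cancel_right,
        add_sub_cancel_right, inv_smul_smul₀ hc]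
    rw [hrec]
    exact S.smul_mem (S.sub_mem (S.sub_mem (S.mul_mem hS (distMatrixOver_mem hG hS _))
      (S.smul_mem (distMatrixOver_mem hG hS _) _)) (S.smul_mem (distMatrixOver_mem hG hS _) _)) _

theorem IsDistanceRegular.distFun_mem (hG : IsDistanceRegular G)
    {S : Subalgebra K (Matrix X X K)} (hS : distMatrixOver G K 1 ∈ S) (g : ℤ → K) :
    distFun G g ∈ S := by
  rw [hG.distFun_eq_sum]
  exact S.sum_mem fun i _ => S.smul_mem (hG.distMatrixOver_mem hS i) _

theorem IsDistanceRegular.mem_adjoin_iff (hG : IsDistanceRegular G) {P : Matrix X X K} :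
    P ∈ Algebra.adjoin K {distMatrixOver G K 1} ↔ ∃ g, P = distFun G g := by
  refine ⟨fun hP => ?_, ?_⟩
  · have hmul {Q : Matrix X X K} (hQ : Q ∈ Algebra.adjoin K {distMatrixOver G K 1}) :
        ∀ g : ℤ → K, ∃ g', Q * distFun G g = distFun G g' := by
      induction hQ using Algebra.adjoin_induction with
      | mem Q hQ =>
        obtain rfl := Set.mem_singleton_iff.1 hQ
        exact fun g => ⟨_, hG.distMatrixOver_one_mul_distFun g⟩
      | algebraMap r =>
        exact fun g => ⟨r • g, by rw [← Algebra.smul_def, map_smul]⟩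
      | add Q Q' _ _ ih ih' =>
        intro g
        obtain ⟨k, hk⟩ := ih g
        obtain ⟨k', hk'⟩ := ih' g
        exact ⟨k + k', by rw [add_mul, hk, hk', map_add]⟩
      | mul Q Q' _ _ ih ih' =>
        intro g
        obtain ⟨k', hk'⟩ := ih' g
        obtain ⟨k, hk⟩ := ih k'
        exact ⟨k, by rw [mul_assoc, hk', hk]⟩
    obtain ⟨g, hg⟩ : ∃ g, P * distMatrixOver G K 0 = distFun G g := hmul hP _
    exact ⟨g, by rw [← hg, hG.distMatrixOver_zero, mul_one]⟩
  · rintro ⟨g, rfl⟩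
    exact hG.distFun_mem (Algebra.self_mem_adjoin_singleton K _) g

end BoseMesner

section Recurrence

variable {K V : Type*} [Field K] [AddCommGroup V] [Module K V] {n : ℕ} {δ : ℕ → V}

theorem eq_smul_sub_of_antisymm [NeZero (2 : K)] {β : K} (hanti : ∀ i ≤ n, δ (n - i) = -δ i)
    (hrec : ∀ i, i + 3 ≤ n → δ (i + 3) - δ i - (β + 1) • (δ (i + 2) - δ (i + 1)) = 0) {i : ℕ}
    (hi : i + 2 ≤ n) : δ (i + 2) = β • δ (i + 1) - δ i := by
  set ε : ℕ → V := fun i => δ (i + 2) - β • δ (i + 1) + δ i with hε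
  have hconst : ∀ i, i + 2 ≤ n → ε i = ε 0 := by
    intro i
    induction i with
    | zero => exact fun _ => rfl
    | succ i ih =>
      intro hi
      rw [← ih (by omega), ← sub_eq_zero, ← hrec i (by omega)]
      module
  have hneg : ε (n - 2) = -ε 0 := by
    simp only [hε, show n - 2 + 2 = n - 0 by omega, show n - 2 + 1 = n - 1 by omega,
      hanti 0 (by omega), hanti 1 (by omega), hanti 2 (by omega)]
    module
  have hzero : ε 0 = 0 := by
    have htwo : (2 : K) • ε 0 = 0 := by
      rw [two_smul]
      nth_rewrite 1 [← hconst (n - 2) (by omega)]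
      rw [hneg, neg_add_cancel]
    exact (smul_eq_zero.1 htwo).resolve_left two_ne_zero
  rw [← sub_eq_zero, ← hzero, ← hconst i hi]
  module

theorem sub_inv_smul_eq_of_recurrence {q : K} (hq0 : q ≠ 0) (h0 : δ 0 = 0)
    (hrec : ∀ i, i + 2 ≤ n → δ (i + 2) = (q + q⁻¹) • δ (i + 1) - δ i) :
    ∀ i ≤ n, (q - q⁻¹) • δ i = (q ^ i - (q ^ i)⁻¹) • δ 1
  | 0, _ => by simp [h0]
  | 1, _ => by simp
  | i + 2, hi => by
    have hqi : q ^ i ≠ 0 := pow_ne_zero _ hq0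
    rw [hrec i hi, smul_sub, smul_comm,
      sub_inv_smul_eq_of_recurrence hq0 h0 hrec (i + 1) (by omega),
      sub_inv_smul_eq_of_recurrence hq0 h0 hrec i (by omega), smul_smul, ← sub_smul]
    congr 1
    simp only [pow_succ]
    field_simp
    ring

theorem eq_zero_of_antisymm_recurrence [NeZero (2 : K)] {q : K} (hq0 : q ≠ 0)
    (hq : ∀ n : ℕ, n ≠ 0 → q ^ n ≠ 1) (h0 : δ 0 = 0) (hanti : ∀ i ≤ n, δ (n - i) = -δ i)
    (hrec : ∀ i, i + 3 ≤ n →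
      δ (i + 3) - δ i - (q + q⁻¹ + 1) • (δ (i + 2) - δ (i + 1)) = 0) {i : ℕ} (hi : i ≤ n) :
    δ i = 0 := by
  have hsol := sub_inv_smul_eq_of_recurrence hq0 h0 fun i => eq_smul_sub_of_antisymm hanti hrec
  have hne (j : ℕ) (hj : j ≠ 0) : q ^ j - (q ^ j)⁻¹ ≠ 0 := by
    intro h
    have hqj : q ^ j ≠ 0 := pow_ne_zero _ hq0
    refine hq (j * 2) (by omega) ?_
    rw [pow_mul, pow_two]
    nth_rewrite 2 [sub_eq_zero.1 h]
    exact mul_inv_cancel₀ hqj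
  have hn : δ n = 0 := by simpa [h0] using hanti 0 n.zero_le
  rcases eq_or_ne n 0 with rfl | hn0
  · rwa [Nat.le_zero.1 hi]
  have h1 : δ 1 = 0 := by
    have hlast := hsol n le_rfl
    rw [hn, smul_zero] at hlast
    exact (smul_eq_zero.1 hlast.symm).resolve_left (hne n hn0)
  have hδi := hsol i hi
  rw [h1, smul_zero] at hδi
  exact (smul_eq_zero.1 hδi).resolve_left (by simpa using hne 1 one_ne_zero)

end Recurrence

section Tridiagonal

variable {K R : Type*} [Field K] [Ring R] [Algebra K R]

/-- The tridiagonal relation `[A, A²S - βASA + SA² - ρS] = 0`. -/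
def IsTridiagonal (β ρ : K) (A S : R) : Prop :=
  Commute A (A ^ 2 * S - β • (A * S * A) + S * A ^ 2 - ρ • S)

variable {β ρ : K} {A S : R}

theorem isTridiagonal_iff : IsTridiagonal β ρ A S ↔
    A ^ 3 * S - S * A ^ 3 - (β + 1) • (A ^ 2 * S * A - A * S * A ^ 2) -
      ρ • (A * S - S * A) = 0 := by
  rw [IsTridiagonal, Commute, SemiconjBy, ← sub_eq_zero]
  refine Eq.congr_left ?_
  simp only [mul_add, mul_sub, add_mul, sub_mul, mul_smul_comm, smul_mul_assoc, pow_succ,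
    pow_zero, one_mul, mul_assoc]
  module

theorem isTridiagonal_iff_sum : IsTridiagonal β ρ A S ↔
    ∑ m, ![1, -1, -(β + 1), β + 1, -ρ, ρ] m •
      (A ^ ![3, 0, 2, 1, 1, 0] m * S * A ^ ![0, 3, 1, 2, 0, 1] m) = 0 := by
  rw [isTridiagonal_iff]
  refine Eq.congr_left ?_
  simp only [Fin.sum_univ_six, Matrix.cons_val, pow_zero, pow_one, one_mul, mul_one]
  module

theorem IsTridiagonal.of_askeyWilson {ω η : K}
    (h : A ^ 2 * S - β • (A * S * A) + S * A ^ 2 - ρ • S = ω • A + η • 1) :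
    IsTridiagonal β ρ A S := by
  rw [IsTridiagonal, h]
  exact ((Commute.refl A).smul_right ω).add_right ((Commute.one_right A).smul_right η)

theorem IsTridiagonal.add_smul_one (h : IsTridiagonal β ρ A S) (ξ : K) :
    IsTridiagonal β ρ A (S + ξ • 1) := by
  have hcomm : Commute A ((2 - β) • A ^ 2 - ρ • 1) :=
    ((Commute.self_pow A 2).smul_right _).sub_right ((Commute.one_right A).smul_right _)
  rw [IsTridiagonal] at h ⊢
  convert h.add_right (hcomm.smul_right ξ) using 1
  simp only [mul_add, add_mul, mul_smul_comm, smul_mul_assoc, mul_one, one_mul, ← pow_two]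
  module

theorem IsTridiagonal.pow_mul_mul_pow (h : IsTridiagonal β ρ A S) (d : ℕ → ℕ → R)
    (hd : ∀ i k, d i k = A ^ i * S * A ^ k - A ^ k * S * A ^ i) (i k : ℕ) :
    d (i + 3) k - d i (k + 3) - (β + 1) • (d (i + 2) (k + 1) - d (i + 1) (k + 2)) -
      ρ • (d (i + 1) k - d i (k + 1)) = 0 := by
  have hsand := congrArg (fun P => A ^ i * P * A ^ k + A ^ k * P * A ^ i) (isTridiagonal_iff.1 h)
  have hleft (m j : ℕ) (T : R) : A ^ (m + j) * (S * T) = A ^ m * (A ^ j * (S * T)) := by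
    rw [pow_add, mul_assoc]
  have hright (m j : ℕ) : S * A ^ (m + j) = S * (A ^ j * A ^ m) := by
    rw [add_comm, pow_add]
  simp only [mul_zero, zero_mul, add_zero, mul_sub, sub_mul, mul_smul_comm, smul_mul_assoc,
    mul_assoc] at hsand
  simp only [hd, mul_assoc, hleft, hright, pow_one]
  rw [← hsand]
  module

theorem IsTridiagonal.pow_mul_pow_sub_mem [NeZero (2 : K)] {q : K} (hq0 : q ≠ 0)
    (hq : ∀ n : ℕ, n ≠ 0 → q ^ n ≠ 1) (h : IsTridiagonal (q + q⁻¹) ρ A S) (M : Submodule K R)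
    (hM : ∀ n, A ^ n * S - S * A ^ n ∈ M) (n : ℕ) :
    ∀ i k : ℕ, i + k = n → A ^ i * S * A ^ k - A ^ k * S * A ^ i ∈ M := by
  induction n using Nat.strong_induction_on with
  | _ n ih =>
  set d : ℕ → ℕ → R := fun i k => A ^ i * S * A ^ k - A ^ k * S * A ^ i with hd
  have hanti (i k : ℕ) : d k i = -d i k := by simp only [hd]; abel
  have hlow (i k : ℕ) (hik : i + k < n) : M.mkQ (d i k) = 0 :=
    (Submodule.Quotient.mk_eq_zero M).2 (ih _ hik i k rfl)
  -- Modulo `M` and by induction, the terms of lower degree in the recurrence vanish.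
  have hrec (i : ℕ) (hi : i + 3 ≤ n) : M.mkQ (d (i + 3) (n - (i + 3))) - M.mkQ (d i (n - i)) -
      (q + q⁻¹ + 1) • (M.mkQ (d (i + 2) (n - (i + 2))) - M.mkQ (d (i + 1) (n - (i + 1)))) = 0 := by
    have hrec := congrArg M.mkQ (h.pow_mul_mul_pow d (fun _ _ => rfl) i (n - (i + 3)))
    simp only [map_sub, map_smul, map_zero] at hrec
    rw [hlow (i + 1) (n - (i + 3)) (by omega), hlow i (n - (i + 3) + 1) (by omega), sub_zero,
      smul_zero, sub_zero] at hrec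
    rwa [show n - (i + 3) + 3 = n - i by omega, show n - (i + 3) + 1 = n - (i + 2) by omega,
      show n - (i + 3) + 2 = n - (i + 1) by omega] at hrec
  have hzero : M.mkQ (d 0 (n - 0)) = 0 := by
    refine (Submodule.Quotient.mk_eq_zero M).2 ?_
    simpa [hd] using M.neg_mem (hM n)
  intro i k hik
  rw [← Submodule.Quotient.mk_eq_zero M, ← Submodule.mkQ_apply, show k = n - i by omega]
  refine eq_zero_of_antisymm_recurrence (δ := fun i => M.mkQ (d i (n - i))) hq0 hq hzero
    (fun i hi => ?_) hrec (by omega)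
  rw [← map_neg, ← hanti, Nat.sub_sub_self hi]

theorem mul_mul_sub_mem_of_mem_adjoin {M : Submodule K R}
    (hM : ∀ i k : ℕ, A ^ i * S * A ^ k - A ^ k * S * A ^ i ∈ M) {P P' : R}
    (hP : P ∈ Algebra.adjoin K {A}) (hP' : P' ∈ Algebra.adjoin K {A}) :
    P * S * P' - P' * S * P ∈ M := by
  rw [← Subalgebra.mem_toSubmodule, Algebra.adjoin_eq_span, ← Submonoid.powers_eq_closure] at hP hP'
  induction hP, hP' using Submodule.span_induction₂ with
  | mem_mem P P' hP hP' =>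
    obtain ⟨i, rfl⟩ := hP
    obtain ⟨k, rfl⟩ := hP'
    exact hM i k
  | zero_left => simp
  | zero_right => simp
  | add_left P Q P' _ _ _ hP hQ =>
    convert M.add_mem hP hQ using 1
    noncomm_ring
  | add_right P P' Q _ _ _ hP' hQ =>
    convert M.add_mem hP' hQ using 1
    noncomm_ring
  | smul_left r P P' _ _ hP =>
    convert M.smul_mem r hP using 1
    simp [smul_sub]
  | smul_right r P P' _ _ hP =>
    convert M.smul_mem r hP using 1
    simp [smul_sub]

theorem IsTridiagonal.exists_mul_mul_sub_eq [NeZero (2 : K)] {q : K} (hq0 : q ≠ 0)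
    (hq : ∀ n : ℕ, n ≠ 0 → q ^ n ≠ 1) (h : IsTridiagonal (q + q⁻¹) ρ A S) {P P' : R}
    (hP : P ∈ Algebra.adjoin K {A}) (hP' : P' ∈ Algebra.adjoin K {A}) :
    ∃ N ∈ Algebra.adjoin K {A}, P * S * P' - P' * S * P = N * S - S * N := by
  let M : Submodule K R := (Subalgebra.toSubmodule (Algebra.adjoin K {A})).map
    (LinearMap.mulRight K S - LinearMap.mulLeft K S)
  have hM (n : ℕ) : A ^ n * S - S * A ^ n ∈ M :=
    ⟨A ^ n, pow_mem (Algebra.self_mem_adjoin_singleton K A) n, rfl⟩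
  obtain ⟨N, hN, hNS⟩ := mul_mul_sub_mem_of_mem_adjoin
    (fun i k => h.pow_mul_pow_sub_mem hq0 hq M hM _ i k rfl) hP hP'
  exact ⟨N, hN, hNS.symm⟩

end Tridiagonal

section Lifting

open Matrix

variable {X : Type*} [Fintype X]

theorem eq_zero_of_sum_mul_transpose_self_eq_zero {T : X → Matrix X X ℝ}
    (h : ∑ x, T x * (T x)ᵀ = 0) (x : X) : T x = 0 := by
  have hnonneg (x : X) : 0 ≤ (T x * (T x)ᵀ).trace := by
    simpa using (posSemidef_self_mul_conjTranspose (T x)).trace_nonneg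
  have htrace : ∑ x, (T x * (T x)ᵀ).trace = 0 := by rw [← trace_sum, h, trace_zero]
  have hx := (Finset.sum_eq_zero_iff_of_nonneg fun x _ => hnonneg x).1 htrace x (Finset.mem_univ x)
  simpa using trace_mul_conjTranspose_self_eq_zero_iff.1 (by simpa using hx)

variable [DecidableEq X]

theorem sum_diagonal_mul_mul_diagonal {R : Type*} [CommRing R] {E : Matrix X X R} {κ : R}
    (hE : E.IsSymm) (hEE : E * E = κ • E) (N : Matrix X X R) :
    ∑ x, diagonal (E x) * N * diagonal (E x) = κ • (E ⊙ N) := by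
  ext y z
  have hyz : ∑ x, E y x * E x z = κ * E y z := congrFun (congrFun hEE y) z
  simp only [Matrix.sum_apply, mul_diagonal, diagonal_mul, Matrix.smul_apply, hadamard_apply,
    smul_eq_mul, ← mul_assoc, ← hyz, Finset.sum_mul]
  exact Finset.sum_congr rfl fun x _ => by rw [hE.apply x y]; ring

/-- Summing `T_x T_xᵀ` over all `x`, where `T_x` is the matrix claimed to vanish, recovers the
hypothesis, because `E` is symmetric and a multiple of an idempotent. -/
theorem sum_mul_diagonal_mul_eq_zero {ι : Type*} [Fintype ι] {E : Matrix X X ℝ} {κ : ℝ}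
    (hE : E.IsSymm) (hEE : E * E = κ • E) {P Q : ι → Matrix X X ℝ}
    (h : ∀ n, ∑ m, P m * (E ⊙ (Q m * (Q n)ᵀ)) = 0) (x : X) :
    ∑ m, P m * diagonal (E x) * Q m = 0 := by
  refine eq_zero_of_sum_mul_transpose_self_eq_zero
    (T := fun x => ∑ m, P m * diagonal (E x) * Q m) ?_ x
  calc ∑ x, (∑ m, P m * diagonal (E x) * Q m) * (∑ n, P n * diagonal (E x) * Q n)ᵀ
      = ∑ n, (∑ m, P m * ∑ x, diagonal (E x) * (Q m * (Q n)ᵀ) * diagonal (E x)) * (P n)ᵀ := by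
        simp only [transpose_sum, transpose_mul, diagonal_transpose, Finset.sum_mul,
          Finset.mul_sum, ← mul_assoc]
        exact Finset.sum_comm.trans (Finset.sum_congr rfl fun n _ => Finset.sum_comm)
    _ = κ • ∑ n, (∑ m, P m * (E ⊙ (Q m * (Q n)ᵀ))) * (P n)ᵀ := by
        simp only [sum_diagonal_mul_mul_diagonal hE hEE, mul_smul_comm, ← Finset.smul_sum,
          smul_mul_assoc]
    _ = 0 := by simp only [h, zero_mul, Finset.sum_const_zero, smul_zero]

end Lifting

section AskeyWilson

variable {K : Type*} [Field K]

theorem threeTerm_sub_smul_one (c a b : ℤ → K) (s : K) :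
    threeTerm c a b - s • 1 = threeTerm c (fun h => a h - s) b := by
  ext g h
  simp only [LinearMap.sub_apply, LinearMap.smul_apply, Module.End.one_apply, Pi.sub_apply,
    Pi.smul_apply, smul_eq_mul, threeTerm_apply]
  ring

/-- The hypotheses compare the coefficients of `g (h ± 2)`, of `g (h ± 1)` and of `g h`. -/
theorem isTridiagonal_threeTerm {c a b f : ℤ → K} {β ρ ω η : K}
    (hf : ∀ h, f (h + 2) - β * f (h + 1) + f h = 0)
    (hoff : ∀ h, a (h + 1) * ((1 - β) * f (h + 1) + f h) +
      a h * (f (h + 1) + (1 - β) * f h) = ω)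
    (hdiag : ∀ h, c h * b (h - 1) * (2 * f h - β * f (h - 1)) +
      b h * c (h + 1) * (2 * f h - β * f (h + 1)) + a h ^ 2 * ((2 - β) * f h) - ρ * f h =
        ω * a h + η) :
    IsTridiagonal β ρ (threeTerm c a b) (LinearMap.mulLeft K f) := by
  refine .of_askeyWilson (ω := ω) (η := η) (LinearMap.ext fun g => funext fun h => ?_)
  have hdown := hf (h - 2)
  have hleft := hoff (h - 1)
  rw [show h - 2 + 2 = h by ring, show h - 2 + 1 = h - 1 by ring] at hdown
  rw [sub_add_cancel] at hleft
  simp only [pow_two, LinearMap.add_apply, LinearMap.sub_apply, LinearMap.smul_apply,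
    Module.End.mul_apply, LinearMap.mulLeft_apply, Module.End.one_apply, Pi.add_apply,
    Pi.sub_apply, Pi.smul_apply, smul_eq_mul, Pi.mul_apply, threeTerm_apply, sub_add_cancel,
    add_sub_cancel_right, show h - 1 - 1 = h - 2 by ring, show h + 1 + 1 = h + 2 by ring]
  linear_combination c h * c (h - 1) * g (h - 2) * hdown + b h * b (h + 1) * g (h + 2) * hf h +
    b h * g (h + 1) * hoff h + c h * g (h - 1) * hleft + g h * hdiag h

end AskeyWilson

section ClassicalSequences

variable {b : ℝ}

/-- The formula for `c_h` of classical parameters, for an integer `h`. -/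
noncomputable def classicalC (b α : ℝ) (h : ℤ) : ℝ :=
  (b ^ h - 1) / (b - 1) * (1 + α * ((b ^ h / b - 1) / (b - 1)))

/-- The formula for `b_h` of classical parameters, for an integer `h` and with `Q = b ^ D`. -/
noncomputable def classicalB (b α β Q : ℝ) (h : ℤ) : ℝ :=
  (Q - b ^ h) / (b - 1) * (β - α * ((b ^ h - 1) / (b - 1)))

/-- The formula `b_0 - b_h - c_h` for `a_h` of classical parameters, for an integer `h`. -/
noncomputable def classicalA (b α β Q : ℝ) (h : ℤ) : ℝ :=
  classicalB b α β Q 0 - classicalB b α β Q h - classicalC b α h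

/-- Multiplication by the adjacency matrix of a graph with classical parameters, as an operator
on sequences. -/
noncomputable def classicalOp (b α β Q : ℝ) : Module.End ℝ (ℤ → ℝ) :=
  threeTerm (classicalC b α) (classicalA b α β Q) (classicalB b α β Q)

/-- The eigenvalues of a graph with classical parameters are `θ_i = s + θ₊ b ^ i + θ₋ b ^ (-i)`;
this is the constant term `s`. -/
noncomputable def eigShift (b α β Q : ℝ) : ℝ :=
  (1 - β) / (b - 1) - α * (Q + 1) / (b - 1) ^ 2

/-- The parameter `ρ = -θ₊ θ₋ (b - b⁻¹) ^ 2` of the tridiagonal relation of a graph with classical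
parameters, where `θ_i = s + θ₊ b ^ i + θ₋ b ^ (-i)` are the eigenvalues. -/
noncomputable def tridiagonalRho (b α β Q : ℝ) : ℝ :=
  -((α / (b - 1) - 1) / (b - 1) * (Q * (β + α / (b - 1)) / (b - 1)) * (b - b⁻¹) ^ 2)

/-- The dual eigenvalues `ξ + b ^ (-h)` of a graph with classical parameters, up to a factor. -/
noncomputable def dualSeq (b ξ : ℝ) (h : ℤ) : ℝ := ξ + (b ^ h)⁻¹

theorem mulLeft_dualSeq (b ξ : ℝ) :
    LinearMap.mulLeft ℝ (dualSeq b ξ) = LinearMap.mulLeft ℝ (dualSeq b 0) + ξ • 1 := by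
  ext g h
  simp only [LinearMap.add_apply, LinearMap.smul_apply, LinearMap.mulLeft_apply,
    Module.End.one_apply, Pi.add_apply, Pi.mul_apply, Pi.smul_apply, smul_eq_mul, dualSeq]
  ring

theorem classicalA_sub_eigShift (hb0 : b ≠ 0) (hb1 : b - 1 ≠ 0) (α β Q : ℝ) (h : ℤ) :
    classicalA b α β Q h - eigShift b α β Q =
      ((β - 1) / (b - 1) + α * (2 + b⁻¹ + Q) / (b - 1) ^ 2) * b ^ h -
        α * (1 + b⁻¹) / (b - 1) ^ 2 * (b ^ h) ^ 2 := by
  simp only [classicalA, classicalB, classicalC, eigShift, zpow_zero]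
  generalize b ^ h = Y
  field_simp
  ring

theorem isTridiagonal_classicalOp (hb0 : b ≠ 0) (hb1 : b - 1 ≠ 0) (α β Q ξ : ℝ) :
    IsTridiagonal (b + b⁻¹) (tridiagonalRho b α β Q)
      (classicalOp b α β Q - eigShift b α β Q • 1) (LinearMap.mulLeft ℝ (dualSeq b ξ)) := by
  rw [mulLeft_dualSeq, classicalOp, threeTerm_sub_smul_one]
  set u := (β - 1) / (b - 1) + α * (2 + b⁻¹ + Q) / (b - 1) ^ 2 with hu
  have hsucc (h : ℤ) : b ^ (h + 1) = b ^ h * b := zpow_add_one₀ hb0 h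
  have hpred (h : ℤ) : b ^ (h - 1) = b ^ h * b⁻¹ := zpow_sub_one₀ hb0 h
  set v := classicalA b α β Q 0 - eigShift b α β Q with hv
  rw [classicalA_sub_eigShift hb0 hb1, ← hu] at hv
  refine IsTridiagonal.add_smul_one (isTridiagonal_threeTerm (ω := -(u * (b - 1) ^ 2 / b))
    (η := classicalB b α β Q 0 * (2 - (b + b⁻¹) / b) + (b - 1) ^ 2 / b * (u * v - v ^ 2) -
      tridiagonalRho b α β Q) (fun h => ?_) (fun h => ?_) fun h => ?_) ξ
  · have hY : b ^ h ≠ 0 := zpow_ne_zero h hb0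
    simp only [dualSeq, hsucc, show h + 2 = h + 1 + 1 by ring]
    field_simp
    ring
  · have hY : b ^ h ≠ 0 := zpow_ne_zero h hb0
    simp only [classicalA_sub_eigShift hb0 hb1, dualSeq, hsucc, ← hu]
    generalize b ^ h = Y at *
    field_simp
    ring
  · have hY : b ^ h ≠ 0 := zpow_ne_zero h hb0
    simp only [classicalA_sub_eigShift hb0 hb1, dualSeq, hsucc, hpred, classicalB, classicalC,
      tridiagonalRho, hv, hu, zpow_zero]
    generalize b ^ h = Y at *
    field_simp
    ring

theorem classicalOp_dualSeq (hb0 : b ≠ 0) (hb1 : b - 1 ≠ 0) {α β Q θ ξ : ℝ}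
    (hθ : θ = classicalB b α β Q 1 / b - 1)
    (hξ : ξ * (classicalB b α β Q 0 - θ) = θ - classicalB b α β Q 0 / b) :
    classicalOp b α β Q (dualSeq b ξ) = θ • dualSeq b ξ := by
  ext h
  have hY : b ^ h ≠ 0 := zpow_ne_zero h hb0
  have hconst : classicalC b α h * (b ^ (h - 1))⁻¹ + classicalA b α β Q h * (b ^ h)⁻¹ +
      classicalB b α β Q h * (b ^ (h + 1))⁻¹ - θ * (b ^ h)⁻¹ =
        classicalB b α β Q 0 / b - θ := by
    simp only [hθ, classicalA, classicalB, classicalC, zpow_zero, zpow_one, zpow_add_one₀ hb0,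
      zpow_sub_one₀ hb0]
    generalize b ^ h = Y at *
    field_simp
    ring
  simp only [classicalOp, threeTerm_apply, dualSeq, Pi.smul_apply, smul_eq_mul]
  rw [classicalA] at hconst ⊢
  linear_combination hξ + hconst

end ClassicalSequences

section Adjoin

variable {K R : Type*} [Field K] [Ring R] [Algebra K R] {A E P : R}

theorem adjoin_sub_smul_one (A : R) (s : K) :
    Algebra.adjoin K {A - s • 1} = Algebra.adjoin K {A} := by
  refine le_antisymm (Algebra.adjoin_singleton_le ?_) (Algebra.adjoin_singleton_le ?_)
  · exact sub_mem (Algebra.self_mem_adjoin_singleton K A) (Subalgebra.smul_mem _ (one_mem _) s)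
  · simpa only [sub_add_cancel] using add_mem (Algebra.self_mem_adjoin_singleton K (A - s • 1))
      (Subalgebra.smul_mem _ (one_mem _) s)

theorem exists_mul_eq_smul_of_mem_adjoin {θ : K} (h : A * E = θ • E)
    (hP : P ∈ Algebra.adjoin K {A}) : ∃ κ : K, P * E = κ • E := by
  induction hP using Algebra.adjoin_induction with
  | mem P hP =>
    obtain rfl := Set.mem_singleton_iff.1 hP
    exact ⟨θ, h⟩
  | algebraMap r => exact ⟨r, (Algebra.smul_def r E).symm⟩
  | add P Q _ _ ihP ihQ =>
    obtain ⟨κ, hκ⟩ := ihP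
    obtain ⟨μ, hμ⟩ := ihQ
    exact ⟨κ + μ, by rw [add_mul, hκ, hμ, add_smul]⟩
  | mul P Q _ _ ihP ihQ =>
    obtain ⟨κ, hκ⟩ := ihP
    obtain ⟨μ, hμ⟩ := ihQ
    exact ⟨μ * κ, by rw [mul_assoc, hμ, mul_smul_comm, hκ, smul_smul]⟩

end Adjoin

section DualAdjacency

open Matrix

variable {X : Type*} [Fintype X] [DecidableEq X] {G : SimpleGraph X}

theorem distMatrixOver_mul_diagonal_mul_apply {R : Type*} [CommRing R] (f : X → R) (i j : ℕ)
    (y z : X) : (distMatrixOver G R i * diagonal f * distMatrixOver G R j) y z =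
      ∑ t ∈ sphere G y i ∩ sphere G z j, f t := by
  rw [Matrix.mul_apply, ← Finset.univ_inter (sphere G y i ∩ sphere G z j), ← Finset.sum_ite_mem]
  refine Finset.sum_congr rfl fun t _ => ?_
  simp only [mul_diagonal, distMatrixOver_apply, Finset.mem_inter, mem_sphere,
    G.dist_comm (u := z) (v := t), ite_and, ite_mul, one_mul, zero_mul, mul_ite, mul_one, mul_zero]
  split_ifs <;> rfl

theorem IsDistanceRegular.isTridiagonal_diagonal (hG : IsDistanceRegular G) {A : Matrix X X ℝ}
    {L : Module.End ℝ (ℤ → ℝ)} {f : ℤ → ℝ} {β ρ κ : ℝ} (hA : A.IsSymm)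
    (hAL : ∀ g, A * distFun G g = distFun G (L g))
    (hf : distFun G f * distFun G f = κ • distFun G f)
    (hL : IsTridiagonal β ρ L (LinearMap.mulLeft ℝ f)) (x : X) :
    IsTridiagonal β ρ A (diagonal fun t => f (G.dist x t)) := by
  have hpow (k : ℕ) : ∀ g, A ^ k * distFun G g = distFun G ((L ^ k) g) := by
    induction k with
    | zero => simp
    | succ k ih => intro g; rw [pow_succ, pow_succ, mul_assoc, hAL, ih, Module.End.mul_apply]
  have hhad (g : ℤ → ℝ) : distFun G f ⊙ distFun G g = distFun G (LinearMap.mulLeft ℝ f g) := rfl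
  have htranspose (k : ℕ) : (A ^ k)ᵀ = distFun G ((L ^ k) (Pi.single (0 : ℕ) 1)) := by
    calc (A ^ k)ᵀ = A ^ k * distMatrixOver G ℝ 0 := by
          rw [hG.distMatrixOver_zero, mul_one, transpose_pow, hA.eq]
      _ = distFun G ((L ^ k) (Pi.single (0 : ℕ) 1)) := hpow k _
  rw [isTridiagonal_iff_sum] at hL ⊢
  generalize ![1, -1, -(β + 1), β + 1, -ρ, ρ] = c at hL ⊢
  generalize ![3, 0, 2, 1, 1, 0] = p at hL ⊢
  generalize ![0, 3, 1, 2, 0, 1] = q at hL ⊢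
  have hlift := sum_mul_diagonal_mul_eq_zero (distFun_isSymm f) hf (P := fun m => c m • A ^ p m)
    (Q := fun m => A ^ q m) (fun n => ?_) x
  · simp only [smul_mul_assoc] at hlift
    exact hlift
  · simpa only [htranspose, hpow, hhad, smul_mul_assoc, LinearMap.sum_apply, LinearMap.smul_apply,
      Module.End.mul_apply, map_sum, map_smul, LinearMap.zero_apply, map_zero] using
      congrArg (distFun G) (LinearMap.congr_fun hL ((L ^ q n) (Pi.single (0 : ℕ) 1)))

end DualAdjacency

section Classical

variable {X : Type*} [Fintype X] [DecidableEq X] {G : SimpleGraph X} {D : ℕ} {b α β : ℝ}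

theorem cNum_eq_classicalC (hG : IsDistanceRegular G) (hcl : HasClassicalParameters G D b α β)
    (hb0 : b ≠ 0) (hb1 : b ≠ 1) : ∀ {h : ℕ}, h ≤ D → (cNum G h : ℝ) = classicalC b α h
  | 0, _ => by simp [hG.cNum_zero, classicalC]
  | h + 1, hh => by
    rw [hcl.2.1 (h + 1) (by omega) hh, bracket, bracket, geom_sum_eq hb1, geom_sum_eq hb1,
      classicalC, zpow_natCast, Nat.add_sub_cancel, pow_succ, mul_div_cancel_right₀ _ hb0]

theorem bNum_eq_classicalB (hG : IsDistanceRegular G) (hcl : HasClassicalParameters G D b α β)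
    (hb1 : b ≠ 1) {h : ℕ} (hh : h ≤ D) : (bNum G h : ℝ) = classicalB b α β (b ^ D) h := by
  obtain ⟨rfl, -, hB⟩ := hcl
  rcases hh.lt_or_eq with hlt | rfl
  · rw [hB _ hlt, bracket, bracket, geom_sum_eq hb1, geom_sum_eq hb1, classicalB, zpow_natCast]
    ring
  · simp [hG.bNum_diam, classicalB]

theorem aNum_eq_classicalA (hG : IsDistanceRegular G) (hcl : HasClassicalParameters G D b α β)
    (hb0 : b ≠ 0) (hb1 : b ≠ 1) {h : ℕ} (hh : h ≤ D) :
    (aNum G h : ℝ) = classicalA b α β (b ^ D) h := by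
  have hk : (cNum G h + aNum G h + bNum G h : ℝ) = bNum G 0 := by
    exact_mod_cast hG.cNum_add_aNum_add_bNum (hcl.1 ▸ hh)
  rw [cNum_eq_classicalC hG hcl hb0 hb1 hh, bNum_eq_classicalB hG hcl hb1 hh,
    bNum_eq_classicalB hG hcl hb1 D.zero_le, Nat.cast_zero] at hk
  rw [classicalA]
  linarith

theorem distMatrixOver_one_mul_distFun_eq_classicalOp (hG : IsDistanceRegular G)
    (hcl : HasClassicalParameters G D b α β) (hb0 : b ≠ 0) (hb1 : b ≠ 1) (g : ℤ → ℝ) :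
    distMatrixOver G ℝ 1 * distFun G g = distFun G (classicalOp b α β (b ^ D) g) := by
  ext y z
  have hh : G.dist y z ≤ D := hcl.1 ▸ hG.dist_le_diam y z
  rw [hG.distMatrixOver_one_mul_distFun, distFun_apply, distFun_apply, classicalOp,
    threeTerm_apply, threeTerm_apply, Int.toNat_natCast, cNum_eq_classicalC hG hcl hb0 hb1 hh,
    aNum_eq_classicalA hG hcl hb0 hb1 hh, bNum_eq_classicalB hG hcl hb1 hh]

theorem exists_classicalOp_dualSeq_eq_smul (hG : IsDistanceRegular G)
    (hcl : HasClassicalParameters G D b α β) (hD : 1 ≤ D) (hb : b < -1) :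
    ∃ θ ξ : ℝ, classicalOp b α β (b ^ D) (dualSeq b ξ) = θ • dualSeq b ξ := by
  have hB0 : 0 ≤ classicalB b α β (b ^ D) 0 := by
    have h := bNum_eq_classicalB hG hcl (by linarith) D.zero_le
    rw [Nat.cast_zero] at h
    exact h ▸ Nat.cast_nonneg _
  have hB1 : classicalB b α β (b ^ D) 1 / b ≤ 0 := by
    have h := bNum_eq_classicalB hG hcl (by linarith) hD
    rw [Nat.cast_one] at h
    exact div_nonpos_of_nonneg_of_nonpos (h ▸ Nat.cast_nonneg _) (by linarith)
  refine ⟨_, _, classicalOp_dualSeq (by linarith) (by linarith) rfl (div_mul_cancel₀ _ ?_)⟩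
  linarith

theorem exists_isTridiagonal_dualSeq (hG : IsDistanceRegular G)
    (hcl : HasClassicalParameters G D b α β) (hD : 1 ≤ D) (hb : b < -1) :
    ∃ ξ, ∀ x, IsTridiagonal (b + b⁻¹) (tridiagonalRho b α β (b ^ D))
      (distMatrixOver G ℝ 1 - eigShift b α β (b ^ D) • 1)
      (Matrix.diagonal fun t => dualSeq b ξ (G.dist x t)) := by
  have hb0 : b ≠ 0 := by linarith
  have hb1 : b ≠ 1 := by linarith
  have hmul := distMatrixOver_one_mul_distFun_eq_classicalOp hG hcl hb0 hb1
  obtain ⟨θ, ξ, hθ⟩ := exists_classicalOp_dualSeq_eq_smul hG hcl hD hb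
  obtain ⟨κ, hκ⟩ : ∃ κ : ℝ, distFun G (dualSeq b ξ) * distFun G (dualSeq b ξ) =
      κ • distFun G (dualSeq b ξ) := by
    refine exists_mul_eq_smul_of_mem_adjoin (θ := θ) ?_ (hG.mem_adjoin_iff.2 ⟨_, rfl⟩)
    rw [hmul, hθ, map_smul]
  refine ⟨ξ, hG.isTridiagonal_diagonal ((distFun_isSymm _).sub (Matrix.isSymm_one.smul _))
    (fun g => ?_) hκ (isTridiagonal_classicalOp hb0 (sub_ne_zero.2 hb1) α β (b ^ D) ξ)⟩
  rw [sub_mul, hmul, smul_mul_assoc, one_mul, LinearMap.sub_apply, LinearMap.smul_apply,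
    Module.End.one_apply, map_sub, map_smul]

/-- Terwilliger's balanced set condition. -/
theorem exists_balanced (hG : IsDistanceRegular G)
    (hcl : HasClassicalParameters G D b α β) (hD : 1 ≤ D) (hb : b < -1) :
    ∃ ξ, ∀ j x, ∃ r : ℝ, ∀ y z, G.dist y z = j →
      ∑ t ∈ sphere G y 1 ∩ sphere G z j, dualSeq b ξ (G.dist x t) -
          ∑ t ∈ sphere G y j ∩ sphere G z 1, dualSeq b ξ (G.dist x t) =
        r * (dualSeq b ξ (G.dist x y) - dualSeq b ξ (G.dist x z)) := by
  have hq (n : ℕ) (hn : n ≠ 0) : b ^ n ≠ 1 := fun h =>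
    (one_lt_pow₀ (a := |b|) (lt_abs.2 (by right; linarith)) hn).ne' (by rw [← abs_pow, h, abs_one])
  obtain ⟨ξ, hξ⟩ := exists_isTridiagonal_dualSeq hG hcl hD hb
  refine ⟨ξ, fun j x => ?_⟩
  obtain ⟨N, hN, hNS⟩ := (hξ x).exists_mul_mul_sub_eq (by linarith) hq
    (P := distMatrixOver G ℝ 1) (P' := distMatrixOver G ℝ j)
    (by rw [adjoin_sub_smul_one]; exact Algebra.self_mem_adjoin_singleton ℝ _)
    (by rw [adjoin_sub_smul_one]; exact hG.mem_adjoin_iff.2 ⟨_, rfl⟩)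
  rw [adjoin_sub_smul_one] at hN
  obtain ⟨g, rfl⟩ := hG.mem_adjoin_iff.1 hN
  refine ⟨-g j, fun y z hyz => ?_⟩
  rw [← distMatrixOver_mul_diagonal_mul_apply, ← distMatrixOver_mul_diagonal_mul_apply,
    ← Matrix.sub_apply, hNS, Matrix.sub_apply, Matrix.mul_diagonal, Matrix.diagonal_mul,
    distFun_apply, hyz]
  ring

end Classical

section TwoValues

theorem sum_eq_card_inter_mul_add {ι R : Type*} [DecidableEq ι] [CommRing R] (s u : Finset ι)
    {f : ι → R} {c c' : R} (h : ∀ t ∈ s ∩ u, f t = c) (h' : ∀ t ∈ s \ u, f t = c') :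
    ∑ t ∈ s, f t = ((s ∩ u).card : R) * (c - c') + s.card * c' := by
  have hcard := Finset.card_sdiff_add_card_inter s u
  rw [← Finset.sum_inter_add_sum_sdiff s u, Finset.sum_congr rfl h, Finset.sum_congr rfl h',
    Finset.sum_const, Finset.sum_const, ← hcard, nsmul_eq_mul, nsmul_eq_mul, Nat.cast_add]
  ring

end TwoValues

section Kites

variable {X : Type*} {G : SimpleGraph X}

/-- `G` has no kites of length at least `2`; kites of smaller length exist in no connected graph. -/
def IsKiteFree (G : SimpleGraph X) : Prop :=
  ∀ i u v w z, ¬ IsKite G (i + 2) u v w z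

theorem isKite_add_two_iff {i : ℕ} {u v w z : X} :
    IsKite G (i + 2) u v w z ↔ G.dist u v = 1 ∧ G.dist v w = 1 ∧ G.dist u w = 1 ∧
      G.dist u z = i + 2 ∧ G.dist v z = i + 1 ∧ G.dist w z = i + 1 := by
  simp only [IsKite, SimpleGraph.dist_eq_one_iff_adj]
  rfl

variable [Fintype X] [DecidableEq X] {D : ℕ} {b α β : ℝ}

theorem IsDistanceRegular.card_sphere_inter_sphere_one (hG : IsDistanceRegular G) {y z : X} {j : ℕ}
    (hyz : G.dist y z = j) : (sphere G y j ∩ sphere G z 1).card = aNum G j := by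
  subst hyz
  rw [Finset.inter_comm, SimpleGraph.dist_comm, hG.card_aNum]

theorem sum_dist_sphere_inter {R : Type*} [CommRing R] (f : ℕ → R) (x : X) (i : ℕ) (s : Finset X) :
    ∑ t ∈ sphere G x i ∩ s, f (G.dist x t) = ((sphere G x i ∩ s).card : R) * f i := by
  rw [Finset.sum_congr rfl fun t ht => congrArg f (mem_sphere.1 (Finset.mem_inter.1 ht).1),
    Finset.sum_const, nsmul_eq_mul]

theorem IsDistanceRegular.sum_dist_sphere_one_inter (hG : IsDistanceRegular G) {R : Type*}
    [CommRing R] (f : ℕ → R) {x y z : X} {j : ℕ} (hxy : G.dist x y = 1)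
    (hyz : G.dist y z = j + 1) (hxz : G.dist x z = j + 2) :
    ∑ t ∈ sphere G y 1 ∩ sphere G z (j + 1), f (G.dist x t) =
      ((sphere G y 1 ∩ sphere G z (j + 1) ∩ sphere G x 1).card : R) * (f 1 - f 2) +
        aNum G (j + 1) * f 2 := by
  rw [← hyz, ← hG.card_aNum, hyz]
  refine sum_eq_card_inter_mul_add _ _ (fun t ht => ?_) (fun t ht => ?_)
  · rw [mem_sphere.1 (Finset.mem_inter.1 ht).2]
  · simp only [Finset.mem_sdiff, Finset.mem_inter, mem_sphere] at ht
    have hxt := hG.1.dist_triangle (u := x) (v := y) (w := t)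
    have htz := hG.1.dist_triangle (u := x) (v := t) (w := z)
    rw [SimpleGraph.dist_comm (u := t)] at htz
    rw [show G.dist x t = 2 by omega]

theorem IsDistanceRegular.sum_dist_inter_sphere_one (hG : IsDistanceRegular G) {R : Type*}
    [CommRing R] (f : ℕ → R) {x y z : X} {j : ℕ} (hxy : G.dist x y = 1)
    (hyz : G.dist y z = j + 1) (hxz : G.dist x z = j + 2) :
    ∑ t ∈ sphere G y (j + 1) ∩ sphere G z 1, f (G.dist x t) =
      ((sphere G y (j + 1) ∩ sphere G z 1 ∩ sphere G x (j + 1)).card : R) *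
        (f (j + 1) - f (j + 2)) + aNum G (j + 1) * f (j + 2) := by
  rw [← hG.card_sphere_inter_sphere_one hyz]
  refine sum_eq_card_inter_mul_add _ _ (fun t ht => ?_) (fun t ht => ?_)
  · rw [mem_sphere.1 (Finset.mem_inter.1 ht).2]
  · simp only [Finset.mem_sdiff, Finset.mem_inter, mem_sphere] at ht
    have hxt := hG.1.dist_triangle (u := x) (v := y) (w := t)
    have htz := hG.1.dist_triangle (u := x) (v := t) (w := z)
    rw [SimpleGraph.dist_comm (u := t)] at htz
    rw [show G.dist x t = j + 2 by omega]

/-- Compare the balanced set condition for `(y, z)` with the one for a pair `(x, z')` at the same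
distance. -/
theorem card_eq_pow_mul_card (hG : IsDistanceRegular G) (hcl : HasClassicalParameters G D b α β)
    (hb : b < -1) {j : ℕ} {x y z : X} (hxy : G.dist x y = 1) (hyz : G.dist y z = j + 1)
    (hxz : G.dist x z = j + 2) :
    ((sphere G y (j + 1) ∩ sphere G z 1 ∩ sphere G x (j + 1)).card : ℝ) =
      b ^ j * (sphere G y 1 ∩ sphere G z (j + 1) ∩ sphere G x 1).card := by
  have hdiam := hG.dist_le_diam x z
  have hb0 : b ≠ 0 := by linarith
  have hb1 : b - 1 ≠ 0 := by linarith
  obtain ⟨ξ, hξ⟩ := exists_balanced hG hcl (by rw [← hcl.1]; omega) hb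
  obtain ⟨r, hr⟩ := hξ (j + 1) x
  obtain ⟨z', hz'⟩ := hG.exists_dist_eq x (h := j + 1) (by omega)
  have hleft := hG.card_aNum x z'
  have hxz' := hr x z' hz'
  rw [hz'] at hleft
  rw [SimpleGraph.dist_self, hz', sum_dist_sphere_inter (fun h => dualSeq b ξ h),
    sum_dist_sphere_inter (fun h => dualSeq b ξ h), hleft,
    hG.card_sphere_inter_sphere_one hz'] at hxz'
  have hbal := hr y z hyz
  rw [hG.sum_dist_sphere_one_inter (fun h => dualSeq b ξ h) hxy hyz hxz,
    hG.sum_dist_inter_sphere_one (fun h => dualSeq b ξ h) hxy hyz hxz, hxy, hxz] at hbal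
  generalize ((sphere G y (j + 1) ∩ sphere G z 1 ∩ sphere G x (j + 1)).card : ℝ) = m at *
  generalize ((sphere G y 1 ∩ sphere G z (j + 1) ∩ sphere G x 1).card : ℝ) = s at *
  simp only [dualSeq, zpow_natCast, pow_succ, pow_zero, one_mul] at hxz' hbal
  have hbj : b ^ j ≠ 0 := pow_ne_zero _ hb0
  refine sub_eq_zero.1 ((mul_eq_zero.1 (?_ : (b - 1) * (m - b ^ j * s) = 0)).resolve_left hb1)
  field_simp at hxz' hbal
  linear_combination hxz' - hbal

theorem not_isKite_of_odd (hG : IsDistanceRegular G) (hcl : HasClassicalParameters G D b α β)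
    (hb : b < -1) {j : ℕ} (hj : Odd j) (x y t z : X) : ¬ IsKite G (j + 2) x y t z := by
  rw [isKite_add_two_iff]
  rintro ⟨hxy, hyt, hxt, hxz, hyz, htz⟩
  have hcard := card_eq_pow_mul_card hG hcl hb hxy hyz hxz
  have hpos : 0 < (sphere G y 1 ∩ sphere G z (j + 1) ∩ sphere G x 1).card :=
    Finset.card_pos.2 ⟨t, by simp [hyt, SimpleGraph.dist_comm (u := z), htz, hxt]⟩
  have hneg := mul_neg_of_neg_of_pos (hj.pow_neg (by linarith : b < 0))
    (Nat.cast_pos (α := ℝ).2 hpos)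
  exact (hcard ▸ hneg).not_ge (Nat.cast_nonneg _)

theorem not_isKite_two (hG : IsDistanceRegular G) (hcl : HasClassicalParameters G D b α β)
    (hD : 3 ≤ D) (hb : b < -1) (x y t z : X) : ¬ IsKite G 2 x y t z := by
  rw [isKite_add_two_iff (i := 0)]
  rintro ⟨hxy, hyt, hxt, hxz, hyz, htz⟩
  obtain ⟨w, hzw, hwx⟩ := hG.exists_dist_eq_one_of_dist_lt_diam (y := z) (z := x)
    (by rw [SimpleGraph.dist_comm, hxz, hcl.1]; omega)
  rw [SimpleGraph.dist_comm (u := z) (v := x), hxz, SimpleGraph.dist_comm] at hwx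
  have hxyw := hG.1.dist_triangle (u := x) (v := y) (w := w)
  have hxtw := hG.1.dist_triangle (u := x) (v := t) (w := w)
  have hyzw := hG.1.dist_triangle (u := y) (v := z) (w := w)
  have htzw := hG.1.dist_triangle (u := t) (v := z) (w := w)
  exact not_isKite_of_odd hG hcl hb odd_one x y t w
    (isKite_add_two_iff.2 ⟨hxy, hyt, hxt, by omega, by omega, by omega⟩)

theorem one_sub_le_one_add_mul_bracket (hb : b < -1) (hα : 1 ≤ (1 + b) * (1 + α)) {j : ℕ}
    (hj : Even j) (hj2 : 2 ≤ j) : 1 - b ≤ 1 + α * bracket b j := by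
  have hsq : 0 < b ^ 2 - 1 := by nlinarith
  have hpow : b ^ 2 ≤ b ^ j := by
    rw [← hj.pow_abs, ← even_two.pow_abs]
    exact pow_le_pow_right₀ (by rw [abs_of_neg (by linarith)]; linarith) hj2
  have hquot : 1 ≤ (b ^ j - 1) / (b ^ 2 - 1) := (one_le_div hsq).2 (by linarith)
  have hfactor : bracket b j = (1 + b) * ((b ^ j - 1) / (b ^ 2 - 1)) := by
    have hb1 : b - 1 ≠ 0 := by linarith
    have hb3 : b + 1 ≠ 0 := by linarith
    rw [bracket, geom_sum_eq (sub_ne_zero.1 hb1), show b ^ 2 - 1 = (b - 1) * (b + 1) by ring]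
    field_simp
    ring
  rw [hfactor]
  nlinarith

theorem pow_lt_cNum (hG : IsDistanceRegular G) (hcl : HasClassicalParameters G D b α β)
    (hb : b < -1) {j : ℕ} (hj : Even j) (hj2 : 2 ≤ j) (hjD : j + 1 ≤ D) :
    b ^ j < cNum G (j + 1) := by
  have hα : (1 : ℝ) ≤ (1 + b) * (1 + α) := by
    have hc : (1 : ℝ) ≤ cNum G 2 := by
      exact_mod_cast hG.cNum_pos (h := 2) (by omega) (by rw [hcl.1]; omega)
    rw [hcl.2.1 2 (by omega) (by omega)] at hc
    simpa [bracket, Finset.sum_range_succ] using hc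
  have hbracket : bracket b (j + 1) * (1 - b) = 1 - b ^ (j + 1) := geom_sum_mul_neg b (j + 1)
  have hpow : 0 < b ^ j := hj.pow_pos (by linarith)
  have hnonneg : 0 ≤ bracket b (j + 1) :=
    nonneg_of_mul_nonneg_left (b := 1 - b) (by rw [hbracket, pow_succ]; nlinarith) (by linarith)
  calc b ^ j < 1 - b ^ (j + 1) := by rw [pow_succ]; nlinarith
    _ = bracket b (j + 1) * (1 - b) := hbracket.symm
    _ ≤ bracket b (j + 1) * (1 + α * bracket b j) :=
      mul_le_mul_of_nonneg_left (one_sub_le_one_add_mul_bracket hb hα hj hj2) hnonneg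
    _ = cNum G (j + 1) := (hcl.2.1 (j + 1) (by omega) hjD).symm

theorem sphere_one_inter_sphere_subset (hG : IsDistanceRegular G) {i : ℕ}
    (hkite : ∀ u v w z, ¬ IsKite G (i + 2) u v w z) {x y z u : X} (hxy : G.dist x y = 1)
    (hyz : G.dist y z = i + 2) (hxz : G.dist x z = i + 3)
    (hu : u ∈ sphere G y 1 ∩ sphere G z (i + 2) ∩ sphere G x 1) :
    sphere G z 1 ∩ sphere G u (i + 1) ⊆
      sphere G y (i + 2) ∩ sphere G z 1 ∩ sphere G x (i + 2) := by
  intro v hv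
  simp only [Finset.mem_inter, mem_sphere] at hu hv ⊢
  obtain ⟨⟨hyu, -⟩, hxu⟩ := hu
  obtain ⟨hzv, huv⟩ := hv
  have hxvz := hG.1.dist_triangle (u := x) (v := v) (w := z)
  have hxuv := hG.1.dist_triangle (u := x) (v := u) (w := v)
  have hyvz := hG.1.dist_triangle (u := y) (v := v) (w := z)
  have hyuv := hG.1.dist_triangle (u := y) (v := u) (w := v)
  rw [SimpleGraph.dist_comm (u := v)] at hxvz hyvz
  refine ⟨⟨?_, hzv⟩, by omega⟩
  by_contra hyv
  exact hkite x y u v (isKite_add_two_iff.2 ⟨hxy, hyu, hxu, by omega, by omega, by omega⟩)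

theorem pairwiseDisjoint_sphere_one_inter_sphere (hG : IsDistanceRegular G) {i : ℕ}
    (hkite : ∀ u v w z, ¬ IsKite G (i + 2) u v w z) (hkite2 : ∀ u v w z, ¬ IsKite G 2 u v w z)
    {x y z : X} (hxy : G.dist x y = 1) (hxz : G.dist x z = i + 3) :
    ((sphere G y 1 ∩ sphere G z (i + 2) ∩ sphere G x 1 : Finset X) : Set X).PairwiseDisjoint
      fun u => sphere G z 1 ∩ sphere G u (i + 1) := by
  intro u hu u' hu' hne
  refine Finset.disjoint_left.2 fun v hv hv' => ?_
  simp only [Finset.mem_coe, Finset.mem_inter, mem_sphere] at hu hu' hv hv'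
  obtain ⟨⟨hyu, -⟩, hxu⟩ := hu
  obtain ⟨⟨hyu', -⟩, hxu'⟩ := hu'
  obtain ⟨hzv, huv⟩ := hv
  have hpos := hG.1.pos_dist_of_ne hne
  have huxu' := hG.1.dist_triangle (u := u) (v := x) (w := u')
  have hxvz := hG.1.dist_triangle (u := x) (v := v) (w := z)
  have hxuv := hG.1.dist_triangle (u := x) (v := u) (w := v)
  rw [SimpleGraph.dist_comm (u := v), hzv] at hxvz
  have hux := SimpleGraph.dist_comm (G := G) (u := x) (v := u)
  have huy := SimpleGraph.dist_comm (G := G) (u := y) (v := u)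
  by_cases huu' : G.dist u u' = 1
  · exact hkite x u u' v (isKite_add_two_iff.2 ⟨hxu, huu', hxu', by omega, huv, hv'.2⟩)
  · exact hkite2 u x y u' ((isKite_add_two_iff (i := 0)).2
      ⟨by omega, hxy, by omega, by omega, hxu', hyu'⟩)

theorem cNum_mul_card_le (hG : IsDistanceRegular G) {i : ℕ}
    (hkite : ∀ u v w z, ¬ IsKite G (i + 2) u v w z) (hkite2 : ∀ u v w z, ¬ IsKite G 2 u v w z)
    {x y z : X} (hxy : G.dist x y = 1) (hyz : G.dist y z = i + 2) (hxz : G.dist x z = i + 3) :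
    (sphere G y 1 ∩ sphere G z (i + 2) ∩ sphere G x 1).card * cNum G (i + 2) ≤
      (sphere G y (i + 2) ∩ sphere G z 1 ∩ sphere G x (i + 2)).card := by
  have hcard (u : X) (hu : u ∈ sphere G y 1 ∩ sphere G z (i + 2) ∩ sphere G x 1) :
      (sphere G z 1 ∩ sphere G u (i + 1)).card = cNum G (i + 2) := by
    have hzu := mem_sphere.1 (Finset.mem_inter.1 (Finset.mem_inter.1 hu).1).2
    rw [← hzu, ← hG.card_cNum, hzu]
    rfl
  rw [← Finset.sum_const_nat hcard,
    ← Finset.card_biUnion (pairwiseDisjoint_sphere_one_inter_sphere hG hkite hkite2 hxy hxz)]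
  exact Finset.card_le_card (Finset.biUnion_subset.2 fun u hu =>
    sphere_one_inter_sphere_subset hG hkite hxy hyz hxz hu)

theorem not_isKite_of_even (hG : IsDistanceRegular G) (hcl : HasClassicalParameters G D b α β)
    (hD : 3 ≤ D) (hb : b < -1) {i : ℕ} (hi : Odd i) (x y t z : X) : ¬ IsKite G (i + 3) x y t z := by
  rw [isKite_add_two_iff (i := i + 1)]
  rintro ⟨hxy, hyt, hxt, hxz, hyz, htz⟩
  have hiD : i + 3 ≤ D := hcl.1 ▸ hxz ▸ hG.dist_le_diam x z
  have hpos : (0 : ℝ) < (sphere G y 1 ∩ sphere G z (i + 2) ∩ sphere G x 1).card :=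
    Nat.cast_pos.2 (Finset.card_pos.2 ⟨t, by simp [hyt, SimpleGraph.dist_comm (u := z), htz, hxt]⟩)
  have hlt := pow_lt_cNum hG hcl hb hi.add_one (by have := hi.pos; omega) (by omega)
  have hle : ((sphere G y 1 ∩ sphere G z (i + 2) ∩ sphere G x 1).card * cNum G (i + 2) : ℝ) ≤
      (sphere G y (i + 2) ∩ sphere G z 1 ∩ sphere G x (i + 2)).card := by
    exact_mod_cast cNum_mul_card_le hG (not_isKite_of_odd hG hcl hb hi)
      (not_isKite_two hG hcl hD hb) hxy hyz hxz
  rw [card_eq_pow_mul_card hG hcl hb hxy hyz hxz, mul_comm] at hle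
  exact (le_of_mul_le_mul_right hle hpos).not_gt hlt

theorem isKiteFree_of_hasClassicalParameters (hG : IsDistanceRegular G)
    (hcl : HasClassicalParameters G D b α β) (hD : 3 ≤ D) (hb : b < -1) : IsKiteFree G := by
  intro j x y t z
  rcases j.even_or_odd with hj | hj
  · rcases j with _ | i
    · exact not_isKite_two hG hcl hD hb x y t z
    · exact not_isKite_of_even hG hcl hD hb (by simpa [Nat.even_add_one] using hj) x y t z
  · exact not_isKite_of_odd hG hcl hb hj x y t z

end Kites

section LocalVector

variable {X : Type*} [Fintype X] {G : SimpleGraph X} {x : X} {w : X → ℂ}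

theorem distMatrix_mulVec_apply (i : ℕ) (w : X → ℂ) (y : X) :
    (distMatrix G i).mulVec w y = ∑ t ∈ sphere G y i, w t := by
  rw [distMatrix_eq_distMatrixOver, distMatrixOver_mulVec]

/-- A vector `w` on `Γ_1(x)` that is orthogonal to the all-ones vector and is an eigenvector of the
local graph at `x` for the eigenvalue `-1`; here `w` is encoded as a vector on all of `X`. -/
structure IsLocalVector (G : SimpleGraph X) (x : X) (w : X → ℂ) : Prop where
  eq_zero : ∀ t, G.dist x t ≠ 1 → w t = 0
  sum_eq_zero : ∑ t, w t = 0
  sum_sphere_one : ∀ t, G.dist x t = 1 → ∑ u ∈ sphere G t 1, w u = -w t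

theorem IsLocalVector.distMatrix_mulVec_apply_self (hw : IsLocalVector G x w) (j : ℕ) :
    (distMatrix G j).mulVec w x = 0 := by
  rw [distMatrix_mulVec_apply]
  by_cases hj : j = 1
  · rw [hj, ← hw.sum_eq_zero]
    exact Finset.sum_subset (Finset.subset_univ _) fun t _ ht => hw.eq_zero t (ht ∘ mem_sphere.2)
  · exact Finset.sum_eq_zero fun t ht => hw.eq_zero t (by rwa [mem_sphere.1 ht])

variable [DecidableEq X]

theorem dualIdempotent_mulVec_apply (x : X) (i : ℕ) (w : X → ℂ) (y : X) :
    (dualIdempotent G x i).mulVec w y = if G.dist x y = i then w y else 0 := by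
  simp [dualIdempotent, Matrix.mulVec_diagonal]

theorem IsLocalVector.sum_inter_sphere_one (hw : IsLocalVector G x w) (f : X → ℂ) (s : Finset X) :
    ∑ t ∈ s ∩ sphere G x 1, f t * w t = ∑ t ∈ s, f t * w t := by
  refine Finset.sum_subset Finset.inter_subset_left fun t hts ht => ?_
  rw [hw.eq_zero t fun h => ht (Finset.mem_inter.2 ⟨hts, mem_sphere.2 h⟩), mul_zero]

/-- Eigenvectors of the local graph for different eigenvalues are orthogonal, and `f` is one for the
eigenvalue `a₁ ≠ -1`. -/
theorem IsLocalVector.sum_mul_eq_zero (hG : IsDistanceRegular G) (hw : IsLocalVector G x w)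
    {f : X → ℂ}
    (hf : ∀ t u, G.dist x t = 1 → G.dist x u = 1 → G.dist t u = 1 → f t = f u) :
    ∑ t, f t * w t = 0 := by
  have hdegree (u : X) (hu : u ∈ sphere G x 1) :
      ∑ _t ∈ sphere G x 1 ∩ sphere G u 1, f u * w u = aNum G 1 * (f u * w u) := by
    have hcard := hG.card_aNum x u
    rw [mem_sphere.1 hu] at hcard
    rw [Finset.sum_const, hcard, nsmul_eq_mul]
  have hlocal (t : X) (ht : t ∈ sphere G x 1) :
      f t * -w t = ∑ u ∈ sphere G t 1 ∩ sphere G x 1, f u * w u := by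
    rw [mem_sphere] at ht
    rw [← hw.sum_sphere_one t ht, hw.sum_inter_sphere_one, Finset.mul_sum]
    refine Finset.sum_congr rfl fun u hu => ?_
    by_cases hxu : G.dist x u = 1
    · rw [hf t u ht hxu (mem_sphere.1 hu)]
    · rw [hw.eq_zero u hxu, mul_zero, mul_zero]
  have heig : -∑ t ∈ sphere G x 1, f t * w t = aNum G 1 * ∑ t ∈ sphere G x 1, f t * w t := by
    calc -∑ t ∈ sphere G x 1, f t * w t
        = ∑ t ∈ sphere G x 1, ∑ u ∈ sphere G t 1 ∩ sphere G x 1, f u * w u := by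
          rw [← Finset.sum_congr rfl hlocal, ← Finset.sum_neg_distrib]
          simp only [mul_neg]
      _ = ∑ u ∈ sphere G x 1, ∑ _t ∈ sphere G x 1 ∩ sphere G u 1, f u * w u := by
          refine Finset.sum_comm' fun t u => ?_
          simp only [Finset.mem_inter, mem_sphere, SimpleGraph.dist_comm (u := t)]
          tauto
      _ = aNum G 1 * ∑ t ∈ sphere G x 1, f t * w t := by
          rw [Finset.sum_congr rfl hdegree, Finset.mul_sum]
  rw [← hw.sum_inter_sphere_one, Finset.univ_inter]
  have hne : (aNum G 1 + 1 : ℂ) ≠ 0 := by exact_mod_cast (aNum G 1).succ_ne_zero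
  exact (mul_eq_zero.1 (by linear_combination -heig)).resolve_left hne

theorem IsLocalVector.distMatrix_add_two_mulVec_apply (hG : IsDistanceRegular G)
    (hkite : IsKiteFree G) (hw : IsLocalVector G x w) {y : X} {i : ℕ} (hy : G.dist x y = i + 1) :
    (distMatrix G (i + 2)).mulVec w y = 0 := by
  have hadj (t u : X) (ht : G.dist x t = 1) (hu : G.dist x u = 1) (htu : G.dist t u = 1)
      (hty : G.dist y t = i + 2) : G.dist y u = i + 2 := by
    by_contra huy
    rw [SimpleGraph.dist_comm] at hty huy
    have htuy := hG.1.dist_triangle (u := t) (v := u) (w := y)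
    have huxy := hG.1.dist_triangle (u := u) (v := x) (w := y)
    rw [SimpleGraph.dist_comm (u := u) (v := x)] at huxy
    exact hkite i t x u y (isKite_add_two_iff.2
      ⟨by rw [SimpleGraph.dist_comm, ht], hu, htu, hty, hy, by omega⟩)
  rw [distMatrix_mulVec_apply]
  refine Eq.trans ?_ (hw.sum_mul_eq_zero hG (f := fun t => if G.dist y t = i + 2 then 1 else 0)
    fun t u ht hu htu => if_congr ⟨hadj t u ht hu htu,
      hadj u t hu ht (by rw [SimpleGraph.dist_comm, htu])⟩ rfl rfl)
  simp only [sphere, Finset.sum_filter, ite_mul, one_mul, zero_mul]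

theorem IsLocalVector.distMatrix_mulVec_apply_eq_zero (hG : IsDistanceRegular G)
    (hkite : IsKiteFree G) (hw : IsLocalVector G x w) {y : X} {i j : ℕ} (hy : G.dist x y = i + 1)
    (hj : j ≠ i) (hj' : j ≠ i + 1) : (distMatrix G j).mulVec w y = 0 := by
  by_cases hj2 : j = i + 2
  · exact hj2 ▸ hw.distMatrix_add_two_mulVec_apply hG hkite hy
  · rw [distMatrix_mulVec_apply]
    refine Finset.sum_eq_zero fun t ht => hw.eq_zero t fun hxt => ?_
    have hty := hG.dist_eq_of_dist_eq_one hxt y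
    rw [SimpleGraph.dist_comm, mem_sphere.1 ht] at hty
    omega

theorem IsLocalVector.distMatrix_succ_mulVec_apply (hG : IsDistanceRegular G)
    (hkite : IsKiteFree G) (hw : IsLocalVector G x w) {y : X} {i : ℕ} (hy : G.dist x y = i + 1) :
    (distMatrix G (i + 1)).mulVec w y = -(distMatrix G i).mulVec w y := by
  have hiD : i + 1 ≤ G.diam := hy ▸ hG.dist_le_diam x y
  have hi : i ∈ Finset.range (G.diam + 1) := Finset.mem_range.2 (by omega)
  have hi' : i + 1 ∈ Finset.range (G.diam + 1) := Finset.mem_range.2 (by omega)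
  rw [eq_neg_iff_add_eq_zero, add_comm]
  calc (distMatrix G i).mulVec w y + (distMatrix G (i + 1)).mulVec w y
      = ∑ j ∈ Finset.range (G.diam + 1), (distMatrix G j).mulVec w y := by
        symm
        refine Finset.sum_eq_add_of_mem i (i + 1) hi hi' (by omega) fun j _ hj => ?_
        exact hw.distMatrix_mulVec_apply_eq_zero hG hkite hy hj.1 hj.2
    _ = ∑ t, w t := by
        simp only [distMatrix_mulVec_apply]
        exact Finset.sum_fiberwise_of_maps_to
          (fun t _ => Finset.mem_range.2 (Nat.lt_succ_of_le (hG.dist_le_diam y t))) w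
    _ = 0 := hw.sum_eq_zero

/-- The vectors `E*_i A_{i-1} w` that are to form a basis; for `i = 0`, where there is no `A_{i-1}`,
the vector is `0`. -/
noncomputable def ladder (G : SimpleGraph X) (x : X) (w : X → ℂ) : ℕ → X → ℂ
  | 0 => 0
  | i + 1 => (dualIdempotent G x (i + 1) * distMatrix G i).mulVec w

theorem ladder_zero (x : X) (w : X → ℂ) : ladder G x w 0 = 0 := rfl

theorem ladder_apply (x : X) (w : X → ℂ) (i : ℕ) (y : X) :
    ladder G x w (i + 1) y = if G.dist x y = i + 1 then (distMatrix G i).mulVec w y else 0 := by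
  rw [ladder, ← Matrix.mulVec_mulVec, dualIdempotent_mulVec_apply]

theorem ladder_apply_of_dist_ne (x : X) (w : X → ℂ) {i : ℕ} {y : X} (h : G.dist x y ≠ i) :
    ladder G x w i y = 0 := by
  cases i with
  | zero => rfl
  | succ i => rw [ladder_apply, if_neg h]

theorem dualIdempotent_mulVec_ladder (x : X) (w : X → ℂ) (i j : ℕ) :
    (dualIdempotent G x i).mulVec (ladder G x w j) = if i = j then ladder G x w j else 0 := by
  ext y
  rw [dualIdempotent_mulVec_apply, ite_apply]
  by_cases hy : G.dist x y = j
  · simp only [hy, eq_comm, Pi.zero_apply]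
  · simp only [ladder_apply_of_dist_ne x w hy, ite_self, Pi.zero_apply]

theorem IsDistanceRegular.ladder_of_diam_lt (hG : IsDistanceRegular G) (x : X) (w : X → ℂ) {i : ℕ}
    (hi : G.diam < i) : ladder G x w i = 0 :=
  funext fun y => ladder_apply_of_dist_ne x w ((hG.dist_le_diam x y).trans_lt hi).ne

theorem IsLocalVector.distMatrix_mulVec_eq (hG : IsDistanceRegular G) (hkite : IsKiteFree G)
    (hw : IsLocalVector G x w) (j : ℕ) :
    (distMatrix G j).mulVec w = ladder G x w (j + 1) - ladder G x w j := by
  ext y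
  rw [Pi.sub_apply]
  rcases hy : G.dist x y with _ | i
  · obtain rfl := hG.1.dist_eq_zero_iff.1 hy
    rw [hw.distMatrix_mulVec_apply_self, ladder_apply_of_dist_ne x w (by omega), zero_sub,
      zero_eq_neg]
    rcases j with _ | j
    · rfl
    · exact ladder_apply_of_dist_ne x w (by omega)
  rcases eq_or_ne j i with rfl | hj
  · rw [ladder_apply, if_pos hy, ladder_apply_of_dist_ne x w (by omega), sub_zero]
  rw [ladder_apply_of_dist_ne x w (i := j + 1) (by omega), zero_sub]
  rcases eq_or_ne j (i + 1) with rfl | hj'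
  · rw [ladder_apply, if_pos hy, hw.distMatrix_succ_mulVec_apply hG hkite hy]
  · rw [ladder_apply_of_dist_ne x w (by omega), neg_zero,
      hw.distMatrix_mulVec_apply_eq_zero hG hkite hy hj hj']

theorem IsDistanceRegular.distMatrix_zero_mulVec (hG : IsDistanceRegular G) (w : X → ℂ) :
    (distMatrix G 0).mulVec w = w := by
  rw [distMatrix_eq_distMatrixOver, hG.distMatrixOver_zero, Matrix.one_mulVec]

theorem IsLocalVector.ladder_one (hG : IsDistanceRegular G) (hw : IsLocalVector G x w) :
    ladder G x w 1 = w := by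
  ext y
  rw [ladder_apply, zero_add, hG.distMatrix_zero_mulVec]
  split_ifs with hy
  · rfl
  · exact (hw.eq_zero y hy).symm

theorem IsLocalVector.distMatrix_one_mulVec_ladder (hG : IsDistanceRegular G) (hkite : IsKiteFree G)
    (hw : IsLocalVector G x w) (i : ℕ) (hi : i < G.diam) :
    (distMatrix G 1).mulVec (ladder G x w (i + 1)) =
      ((bNum G 0 : ℂ) - cNum G (i + 1) - bNum G i) • ladder G x w (i + 1) +
        (bNum G i : ℂ) • ladder G x w i + (cNum G (i + 1) : ℂ) • ladder G x w (i + 2) := by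
  have hstep := hw.distMatrix_mulVec_eq hG hkite
  induction i with
  | zero =>
    have hw1 : (distMatrix G 1).mulVec (ladder G x w 1) = ladder G x w 2 - ladder G x w 1 := by
      rw [← hstep, hw.ladder_one hG]
    rw [zero_add, zero_add, hw1, hG.cNum_one hi, ladder_zero]
    module
  | succ i ih =>
    have hrec : distMatrix G 1 * distMatrix G (i + 1) =
        (cNum G (i + 2) : ℂ) • distMatrix G (i + 2) +
          (aNum G (i + 1) : ℂ) • distMatrix G (i + 1) + (bNum G i : ℂ) • distMatrix G i := by
      simp only [distMatrix_eq_distMatrixOver]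
      exact hG.distMatrixOver_one_mul i
    have hval : (cNum G (i + 1) + aNum G (i + 1) + bNum G (i + 1) : ℂ) = bNum G 0 := by
      exact_mod_cast hG.cNum_add_aNum_add_bNum hi.le
    have hsucc : ladder G x w (i + 1 + 1) =
        (distMatrix G (i + 1)).mulVec w + ladder G x w (i + 1) := by
      rw [hstep, sub_add_cancel]
    calc (distMatrix G 1).mulVec (ladder G x w (i + 1 + 1))
        = (distMatrix G 1 * distMatrix G (i + 1)).mulVec w +
            (distMatrix G 1).mulVec (ladder G x w (i + 1)) := by
          rw [hsucc, Matrix.mulVec_add, Matrix.mulVec_mulVec]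
      _ = _ := by
          simp only [hrec, ih (by omega), Matrix.add_mulVec, Matrix.smul_mulVec, hstep, ← hval]
          module

/-- By the three-term relation `E*_{i+1} A v_{i+2} = b_{i+1} v_{i+1}`, so the `v_i` vanish only if
`v_1 = w` does. -/
theorem IsLocalVector.ladder_ne_zero (hG : IsDistanceRegular G) (hkite : IsKiteFree G)
    (hw : IsLocalVector G x w) (hw0 : w ≠ 0) (i : ℕ) (hi : i < G.diam) :
    ladder G x w (i + 1) ≠ 0 := by
  induction i with
  | zero => rwa [zero_add, hw.ladder_one hG]
  | succ i ih =>
    intro hzero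
    have hlower : (dualIdempotent G x (i + 1)).mulVec
        ((distMatrix G 1).mulVec (ladder G x w (i + 2))) =
          (bNum G (i + 1) : ℂ) • ladder G x w (i + 1) := by
      simp only [hw.distMatrix_one_mulVec_ladder hG hkite (i + 1) hi, Matrix.mulVec_add,
        Matrix.mulVec_smul, dualIdempotent_mulVec_ladder, if_true,
        if_neg (show i + 1 ≠ i + 2 by omega), if_neg (show i + 1 ≠ i + 3 by omega), smul_zero,
        zero_add, add_zero]
    rw [hzero, Matrix.mulVec_zero, Matrix.mulVec_zero, eq_comm, smul_eq_zero] at hlower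
    exact ih (by omega) (hlower.resolve_left (Nat.cast_ne_zero.2 (hG.bNum_pos hi).ne'))

end LocalVector

section TModule

variable {X : Type*} [Fintype X] [DecidableEq X] {G : SimpleGraph X} {x : X} {w : X → ℂ}
  {W : Submodule ℂ (X → ℂ)}

theorem distMatrix_mem_terwilligerAlgebra (x : X) {i : ℕ} (hi : i ≤ G.diam) :
    distMatrix G i ∈ terwilligerAlgebra G x :=
  Algebra.subset_adjoin (Or.inl (Submodule.subset_span ⟨i, hi, rfl⟩))

theorem dualIdempotent_mem_terwilligerAlgebra (x : X) {i : ℕ} (hi : i ≤ G.diam) :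
    dualIdempotent G x i ∈ terwilligerAlgebra G x :=
  Algebra.subset_adjoin (Or.inr (Submodule.subset_span ⟨i, hi, rfl⟩))

/-- The algebra of matrices that map the subspace `U` into itself; `U` is a `T`-module when it
contains `T`. -/
def stabilizer (U : Submodule ℂ (X → ℂ)) : Subalgebra ℂ (Matrix X X ℂ) where
  carrier := {B | ∀ u ∈ U, B.mulVec u ∈ U}
  mul_mem' {B B'} hB hB' u hu := by
    rw [← Matrix.mulVec_mulVec]
    exact hB _ (hB' u hu)
  add_mem' {B B'} hB hB' u hu := by
    rw [Matrix.add_mulVec]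
    exact U.add_mem (hB u hu) (hB' u hu)
  algebraMap_mem' r u hu := by
    rw [Algebra.algebraMap_eq_smul_one, Matrix.smul_mulVec, Matrix.one_mulVec]
    exact U.smul_mem r hu

/-- `A` generates the Bose–Mesner algebra, so `T` is generated by `A` and the `E*_i`. -/
theorem IsDistanceRegular.isTModule_of_forall_mem (hG : IsDistanceRegular G)
    {U : Submodule ℂ (X → ℂ)} (hA : ∀ u ∈ U, (distMatrix G 1).mulVec u ∈ U)
    (hE : ∀ i, ∀ u ∈ U, (dualIdempotent G x i).mulVec u ∈ U) : IsTModule G x U := by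
  have hM : boseMesner G ≤ (stabilizer U).toSubmodule := by
    refine Submodule.span_le.2 ?_
    rintro _ ⟨i, -, rfl⟩
    rw [distMatrix_eq_distMatrixOver]
    exact hG.distMatrixOver_mem (S := stabilizer U) (by rwa [← distMatrix_eq_distMatrixOver]) i
  have hM' : dualBoseMesner G x ≤ (stabilizer U).toSubmodule := by
    refine Submodule.span_le.2 ?_
    rintro _ ⟨i, -, rfl⟩
    exact hE i
  have hT : terwilligerAlgebra G x ≤ stabilizer U := Algebra.adjoin_le (Set.union_subset hM hM')
  exact fun B hB => hT hB

theorem IsTModule.dualComponent_le (hW : IsTModule G x W) {i : ℕ} (hi : i ≤ G.diam) :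
    dualComponent G x i W ≤ W := by
  rintro _ ⟨u, hu, rfl⟩
  exact hW _ (dualIdempotent_mem_terwilligerAlgebra x hi) u hu

theorem IsTModule.ladder_mem (hW : IsTModule G x W) (hw : w ∈ W) {i : ℕ} (hi : i < G.diam) :
    ladder G x w (i + 1) ∈ W :=
  hW _ (mul_mem (dualIdempotent_mem_terwilligerAlgebra x hi)
    (distMatrix_mem_terwilligerAlgebra x hi.le)) w hw

theorem dualComponent_eq_bot_of_lt_endpoint {i : ℕ} (hi : i ≤ G.diam) (h : i < endpoint G x W) :
    dualComponent G x i W = ⊥ := by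
  by_contra hne
  exact Nat.notMem_of_lt_sInf h ⟨hi, hne⟩

theorem one_le_diam_of_endpoint_eq_one (hend : endpoint G x W = 1) : 1 ≤ G.diam := by
  have hmem : endpoint G x W ∈ dualSupport G x W :=
    Nat.sInf_mem (Nat.nonempty_of_pos_sInf (Nat.one_pos.trans_eq hend.symm))
  exact hend ▸ hmem.1

theorem apply_eq_zero_of_mem_dualComponent {i : ℕ} (hw : w ∈ dualComponent G x i W) {t : X}
    (ht : G.dist x t ≠ i) : w t = 0 := by
  obtain ⟨u, -, rfl⟩ := hw
  rw [Matrix.mulVecLin_apply, dualIdempotent_mulVec_apply, if_neg ht]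

theorem dualIdempotent_mulVec_of_mem_dualComponent {i : ℕ} (hw : w ∈ dualComponent G x i W) :
    (dualIdempotent G x i).mulVec w = w := by
  ext t
  rw [dualIdempotent_mulVec_apply]
  exact ite_eq_left_iff.2 fun ht => (apply_eq_zero_of_mem_dualComponent hw ht).symm

theorem isLocalVector_of_mem_dualComponent (hW : IsTModule G x W) (hend : endpoint G x W = 1)
    (hloc : HasLocalEigenvalue G x W (-1)) (hw : w ∈ dualComponent G x 1 W) :
    IsLocalVector G x w where
  eq_zero _ := apply_eq_zero_of_mem_dualComponent hw
  sum_eq_zero := by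
    have hdiam := one_le_diam_of_endpoint_eq_one hend
    have hmem : (dualIdempotent G x 0).mulVec ((distMatrix G 1).mulVec w) ∈
        dualComponent G x 0 W :=
      ⟨_, hW _ (distMatrix_mem_terwilligerAlgebra x hdiam) w (hW.dualComponent_le hdiam hw), rfl⟩
    rw [dualComponent_eq_bot_of_lt_endpoint (Nat.zero_le _) (by omega), Submodule.mem_bot] at hmem
    have hsum := congrFun hmem x
    rw [dualIdempotent_mulVec_apply, if_pos SimpleGraph.dist_self, distMatrix_mulVec_apply] at hsum
    rw [← Finset.sum_subset (Finset.subset_univ (sphere G x 1)) fun t _ ht =>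
      apply_eq_zero_of_mem_dualComponent hw (ht ∘ mem_sphere.2)]
    exact hsum
  sum_sphere_one t ht := by
    have heig := congrFun (hloc.2 w hw) t
    rwa [← Matrix.mulVec_mulVec, ← Matrix.mulVec_mulVec,
      dualIdempotent_mulVec_of_mem_dualComponent hw, dualIdempotent_mulVec_apply, if_pos ht,
      distMatrix_mulVec_apply, neg_one_smul] at heig

/-- The span of the vectors `E*_i A_{i-1} w`, `1 ≤ i ≤ D`. -/
def ladderSpan (G : SimpleGraph X) (x : X) (w : X → ℂ) : Submodule ℂ (X → ℂ) :=
  Submodule.span ℂ (Set.range fun i : Fin G.diam => ladder G x w (i + 1))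

theorem IsDistanceRegular.ladder_mem_ladderSpan (hG : IsDistanceRegular G) (x : X) (w : X → ℂ)
    (i : ℕ) : ladder G x w i ∈ ladderSpan G x w := by
  rcases i with _ | i
  · exact Submodule.zero_mem _
  rcases lt_or_ge i G.diam with hi | hi
  · exact Submodule.subset_span ⟨⟨i, hi⟩, rfl⟩
  · rw [hG.ladder_of_diam_lt x w (Nat.lt_succ_of_le hi)]
    exact Submodule.zero_mem _

theorem mulVec_mem_ladderSpan {B : Matrix X X ℂ}
    (hB : ∀ i < G.diam, B.mulVec (ladder G x w (i + 1)) ∈ ladderSpan G x w) :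
    ∀ u ∈ ladderSpan G x w, B.mulVec u ∈ ladderSpan G x w := by
  have hle : ladderSpan G x w ≤ (ladderSpan G x w).comap B.mulVecLin := by
    refine Submodule.span_le.2 ?_
    rintro _ ⟨i, rfl⟩
    exact hB i i.2
  exact fun u hu => hle hu

theorem IsLocalVector.isTModule_ladderSpan (hG : IsDistanceRegular G) (hkite : IsKiteFree G)
    (hw : IsLocalVector G x w) : IsTModule G x (ladderSpan G x w) := by
  have hmem := hG.ladder_mem_ladderSpan x w
  refine hG.isTModule_of_forall_mem (mulVec_mem_ladderSpan fun i hi => ?_)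
    fun j => mulVec_mem_ladderSpan fun i _ => ?_
  · rw [hw.distMatrix_one_mulVec_ladder hG hkite i hi]
    exact add_mem (add_mem (Submodule.smul_mem _ _ (hmem _)) (Submodule.smul_mem _ _ (hmem _)))
      (Submodule.smul_mem _ _ (hmem _))
  · rw [dualIdempotent_mulVec_ladder]
    split_ifs
    · exact hmem _
    · exact Submodule.zero_mem _

theorem IsIrreducibleTModule.ladderSpan_eq (hW : IsIrreducibleTModule G x W)
    (hG : IsDistanceRegular G) (hkite : IsKiteFree G) (hw : IsLocalVector G x w) (hwW : w ∈ W)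
    (hw0 : w ≠ 0) : ladderSpan G x w = W := by
  refine (hW.2.2 _ (hw.isTModule_ladderSpan hG hkite) (Submodule.span_le.2 ?_)).resolve_left ?_
  · rintro _ ⟨i, rfl⟩
    exact hW.1.ladder_mem hwW i.2
  · refine fun hbot => hw0 ?_
    have hmem := hG.ladder_mem_ladderSpan x w 1
    rwa [hbot, hw.ladder_one hG, Submodule.mem_bot] at hmem

theorem IsLocalVector.linearIndependent_ladder (hG : IsDistanceRegular G) (hkite : IsKiteFree G)
    (hw : IsLocalVector G x w) (hw0 : w ≠ 0) :
    LinearIndependent ℂ fun i : Fin G.diam => ladder G x w (i + 1) := by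
  refine Fintype.linearIndependent_iff.2 fun g hg i => ?_
  have hproj : g i • ladder G x w (i + 1) = 0 := by
    calc g i • ladder G x w (i + 1)
        = (dualIdempotent G x (i + 1)).mulVec (∑ j : Fin G.diam, g j • ladder G x w (j + 1)) := by
          simp only [Matrix.mulVec_sum, Matrix.mulVec_smul, dualIdempotent_mulVec_ladder,
            Nat.add_right_cancel_iff, Fin.val_inj, smul_ite, smul_zero, Finset.sum_ite_eq,
            Finset.mem_univ, if_true]
      _ = 0 := by rw [hg, Matrix.mulVec_zero]
  exact (smul_eq_zero.1 hproj).resolve_right (hw.ladder_ne_zero hG hkite hw0 i i.2)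

theorem IsIrreducibleTModule.exists_basis_ladder (hW : IsIrreducibleTModule G x W)
    (hG : IsDistanceRegular G) (hkite : IsKiteFree G) (hw : IsLocalVector G x w) (hwW : w ∈ W)
    (hw0 : w ≠ 0) :
    ∃ B : Module.Basis (Fin G.diam) ℂ W, ∀ i, (B i : X → ℂ) = ladder G x w (i + 1) := by
  obtain rfl := hW.ladderSpan_eq hG hkite hw hwW hw0
  have hli := hw.linearIndependent_ladder hG hkite hw0
  exact ⟨Module.Basis.span hli, fun i => congrArg Subtype.val (Module.Basis.span_apply hli i)⟩

theorem dualComponent_ladderSpan (x : X) (w : X → ℂ) {i : ℕ} (hi : i < G.diam) :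
    dualComponent G x (i + 1) (ladderSpan G x w) =
      Submodule.span ℂ {ladder G x w (i + 1)} := by
  rw [dualComponent, ladderSpan, Submodule.map_span]
  refine le_antisymm (Submodule.span_le.2 ?_) (Submodule.span_le.2 ?_)
  · rintro _ ⟨_, ⟨k, rfl⟩, rfl⟩
    rw [Matrix.mulVecLin_apply, dualIdempotent_mulVec_ladder]
    split_ifs with h
    · exact h ▸ Submodule.mem_span_singleton_self _
    · exact Submodule.zero_mem _
  · refine Set.singleton_subset_iff.2 (Submodule.subset_span ⟨_, ⟨⟨i, hi⟩, rfl⟩, ?_⟩)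
    rw [Matrix.mulVecLin_apply, dualIdempotent_mulVec_ladder, if_pos rfl]

theorem IsIrreducibleTModule.finrank_dualComponent (hW : IsIrreducibleTModule G x W)
    (hG : IsDistanceRegular G) (hkite : IsKiteFree G) (hw : IsLocalVector G x w) (hwW : w ∈ W)
    (hw0 : w ≠ 0) {i : ℕ} (hi : i < G.diam) :
    Module.finrank ℂ (dualComponent G x (i + 1) W) = 1 := by
  rw [← hW.ladderSpan_eq hG hkite hw hwW hw0, dualComponent_ladderSpan x w hi]
  exact finrank_span_singleton (hw.ladder_ne_zero hG hkite hw0 i hi)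

theorem moduleDiameter_of_finrank_dualComponent (hend : endpoint G x W = 1)
    (hdim : ∀ i, 1 ≤ i → i ≤ G.diam → Module.finrank ℂ (dualComponent G x i W) = 1) :
    moduleDiameter G x W = G.diam - 1 := by
  have hsupp : dualSupport G x W = Set.Icc 1 G.diam := by
    ext i
    refine ⟨fun ⟨hi, hne⟩ => ⟨hend ▸ Nat.sInf_le ⟨hi, hne⟩, hi⟩, fun ⟨hi, hi'⟩ => ⟨hi', ?_⟩⟩
    exact Submodule.one_le_finrank_iff.1 (hdim i hi hi').ge
  rw [moduleDiameter, hsupp, ← Finset.coe_Icc, Set.ncard_coe_finset, Nat.card_Icc,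
    Nat.add_sub_cancel]

end TModule

end DRG

theorem theorem10p2_general {X : Type*} [Fintype X] [DecidableEq X] (G : SimpleGraph X)
    (hG : DRG.IsDistanceRegular G) (hkite : DRG.IsKiteFree G) (x : X)
    (W : Submodule ℂ (X → ℂ)) (hW : DRG.IsIrreducibleTModule G x W)
    (hend : DRG.endpoint G x W = 1) (hloc : DRG.HasLocalEigenvalue G x W (-1)) :
    (∀ w ∈ DRG.dualComponent G x 1 W, w ≠ 0 →
      ∃ B : Module.Basis (Fin G.diam) ℂ W, ∀ i : Fin G.diam,
        (B i : X → ℂ) =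
          (DRG.dualIdempotent G x ((i : ℕ) + 1) * DRG.distMatrix G (i : ℕ)).mulVec w) ∧
    (∀ i : ℕ, 1 ≤ i → i ≤ G.diam → Module.finrank ℂ (DRG.dualComponent G x i W) = 1) ∧
    Module.finrank ℂ W = G.diam ∧
    DRG.moduleDiameter G x W = G.diam - 1 := by
  have hlocal (w) (hw : w ∈ DRG.dualComponent G x 1 W) : DRG.IsLocalVector G x w :=
    DRG.isLocalVector_of_mem_dualComponent hW.1 hend hloc hw
  have hle := hW.1.dualComponent_le (DRG.one_le_diam_of_endpoint_eq_one hend)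
  have hbasis (w) (hw : w ∈ DRG.dualComponent G x 1 W) (hw0 : w ≠ 0) :=
    hW.exists_basis_ladder hG hkite (hlocal w hw) (hle hw) hw0
  obtain ⟨w, hw, hw0⟩ := Submodule.exists_mem_ne_zero_of_ne_bot hloc.1
  have hdim (i : ℕ) (hi : 1 ≤ i) (hi' : i ≤ G.diam) :
      Module.finrank ℂ (DRG.dualComponent G x i W) = 1 := by
    obtain ⟨i, rfl⟩ := Nat.exists_eq_add_of_le' hi
    exact hW.finrank_dualComponent hG hkite (hlocal w hw) (hle hw) hw0 hi'
  obtain ⟨B, -⟩ := hbasis w hw hw0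
  exact ⟨hbasis, hdim, Module.finrank_eq_card_basis B |>.trans (Fintype.card_fin _),
    DRG.moduleDiameter_of_finrank_dualComponent hend hdim⟩

theorem theorem10p2 {X : Type*} [Fintype X] [DecidableEq X] (G : SimpleGraph X)
    (hG : DRG.IsDistanceRegular G) (D : ℕ) (hD : 3 ≤ D) (b α β : ℝ)
    (hcl : DRG.HasClassicalParameters G D b α β) (hb : b < -1)
    (ha : DRG.aNum G 1 ≠ 0) (hnp : ¬ DRG.IsNearPolygon G) (x : X)
    (W : Submodule ℂ (X → ℂ)) (hW : DRG.IsIrreducibleTModule G x W)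
    (hend : DRG.endpoint G x W = 1) (hloc : DRG.HasLocalEigenvalue G x W (-1)) :
    (∀ w ∈ DRG.dualComponent G x 1 W, w ≠ 0 →
      ∃ B : Module.Basis (Fin D) ℂ W, ∀ i : Fin D,
        (B i : X → ℂ) =
          (DRG.dualIdempotent G x ((i : ℕ) + 1) * DRG.distMatrix G (i : ℕ)).mulVec w) ∧
    (∀ i : ℕ, 1 ≤ i → i ≤ D → Module.finrank ℂ (DRG.dualComponent G x i W) = 1) ∧
    Module.finrank ℂ W = D ∧
    DRG.moduleDiameter G x W = D - 1 := by
  obtain rfl := hcl.1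
  exact theorem10p2_general G hG (DRG.isKiteFree_of_hasClassicalParameters hG hcl hD hb) x W hW
    hend hloc
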